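/- Let $N$ be a connected nilpotent real Lie group with Lie algebra $\mathfrak n=T_1N$, let $H$ be a Lie group acting smoothly on $N$ by automorphisms, and let $G=N\rtimes H$ act on $M=G/H\cong N$ by $(a,h)\cdot x=a\,h(x)$. Let $ds^2$ be a $G$-invariant pseudo-Riemannian metric on $M$ of trans-Lorentz signature $(n-2,2)$, $n=\dim M$ (that is, $ds^2$ is a left-invariant metric on $N$, and $H$ acts by isometric automorphisms). Suppose that $(M,ds^2)$ is $G$-geodesic orbit: every geodesic of $M$ is an orbit of a one-parameter subgroup of $G$ up to reparametrization, in the sense that for every geodesic $\gamma:J\to M$ ($J\subset\mathbb R$ an open interval, $\gamma$ affinely parametrized) and every $t_0\in J$ there are a one-parameter subgroup $c:\mathbb R\to G$ and a function $\theta$, smooth near $t_0$, with $\theta(t_0)=0$ and $\theta'(t_0)\neq 0$, such that $\gamma(t)=c(\theta(t))\cdot\gamma(t_0)$ for all $t$ near $t_0$. Let $\langle\cdot,\cdot\rangle$ be the inner product on $\mathfrak n$ induced by $ds^2$. If the restriction of $\langle\cdot,\cdot\rangle$ to the derived algebra $\mathfrak n'=[\mathfrak n,\mathfrak n]$ is nondegenerate,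 then $N$ is either abelian or $2$-step nilpotent. -/

import Mathlib

open scoped Manifold ContDiff Bundle

noncomputable section

section Geometry

variable {E : Type*} [NormedAddCommGroup E] [NormedSpace ℝ E]
  {M : Type*} [TopologicalSpace M] [ChartedSpace E M] [IsManifold 𝓘(ℝ, E) ∞ M]

/-- A smooth pseudo-Riemannian metric: a smooth field of nondegenerate symmetric bilinear forms on
the tangent spaces. -/
structure PseudoRiemannianMetric (E : Type*) [NormedAddCommGroup E] [NormedSpace ℝ E]
    (M : Type*) [TopologicalSpace M] [ChartedSpace E M] [IsManifold 𝓘(ℝ, E) ∞ M] where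
  /-- The scalar product on the tangent space at `x`. -/
  inner (x : M) : TangentSpace 𝓘(ℝ, E) x →L[ℝ] TangentSpace 𝓘(ℝ, E) x →L[ℝ] ℝ
  symm (x : M) (v w : TangentSpace 𝓘(ℝ, E) x) : inner x v w = inner x w v
  nondegenerate (x : M) (v : TangentSpace 𝓘(ℝ, E) x) (hv : ∀ w, inner x v w = 0) : v = 0
  contMDiff : ContMDiff 𝓘(ℝ, E) (𝓘(ℝ, E).prod 𝓘(ℝ, E →L[ℝ] E →L[ℝ] ℝ)) ∞
    (fun x ↦ Bundle.TotalSpace.mk' (E →L[ℝ] E →L[ℝ] ℝ)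
      (E := fun x ↦ TangentSpace 𝓘(ℝ, E) x →L[ℝ] TangentSpace 𝓘(ℝ, E) x →L[ℝ] ℝ) x (inner x))

namespace PseudoRiemannianMetric

/-- The quadratic form `v ↦ g(v, v)` on the tangent space at `x`. -/
def quadraticForm (g : PseudoRiemannianMetric E M) (x : M) :
    QuadraticForm ℝ (TangentSpace 𝓘(ℝ, E) x) :=
  LinearMap.BilinMap.toQuadraticMap (g.inner x).toLinearMap₁₂

/-- The metric has signature `(p, q)`: `p` positive and `q` negative squares at every point. -/
def HasSignature (g : PseudoRiemannianMetric E M) (p q : ℕ) : Prop :=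
  ∀ x, sigPos (g.quadraticForm x) = p ∧ sigNeg (g.quadraticForm x) = q

/-- Trans-Lorentz metrics: signature `(n - 2, 2)`, where `n` is the dimension. (A negative definite
plane exists only if `2 ≤ n`, so the subtraction is not truncated.) -/
def IsTransLorentz (g : PseudoRiemannianMetric E M) : Prop :=
  g.HasSignature (Module.finrank ℝ E - 2) 2

/-- The map `f` preserves the metric. -/
def IsIsometry (g : PseudoRiemannianMetric E M) (f : M → M) : Prop :=
  ∀ (x : M) (v w : TangentSpace 𝓘(ℝ, E) x),
    g.inner (f x) (mfderiv 𝓘(ℝ, E) 𝓘(ℝ, E) f x v) (mfderiv 𝓘(ℝ, E) 𝓘(ℝ, E) f x w) =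
      g.inner x v w

/-- The metric tensor in the chart around `x₀`, as a field of bilinear forms on the chart
domain in `E`: the pull-back of the metric by the inverse of the chart. -/
def coord (g : PseudoRiemannianMetric E M) (x₀ : M) (y : E) : E →L[ℝ] E →L[ℝ] ℝ :=
  let B : E →L[ℝ] E →L[ℝ] ℝ := g.inner ((extChartAt 𝓘(ℝ, E) x₀).symm y)
  let D : E →L[ℝ] E := mfderiv 𝓘(ℝ, E) 𝓘(ℝ, E) (extChartAt 𝓘(ℝ, E) x₀).symm y
  B.bilinearComp D D

/-- The Christoffel symbols of the first kind of the Levi-Civita connection in the chart around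
`x₀`: `christoffel g x₀ y u w v` is `g(∇ᵤ w, v)` at `y` for constant fields `u`, `w`, `v`, that is
`(∂ᵤ g(w, v) + ∂_w g(u, v) - ∂ᵥ g(u, w)) / 2`. -/
def christoffel (g : PseudoRiemannianMetric E M) (x₀ : M) (y u w v : E) : ℝ :=
  (fderiv ℝ (g.coord x₀) y u w v + fderiv ℝ (g.coord x₀) y w u v
    - fderiv ℝ (g.coord x₀) y v u w) / 2

/-- The curve `γ` is a geodesic on the open set of times `J`: it is `C²` there, and at each time
`t ∈ J` it satisfies `∇_γ' γ' = 0`. In the chart around `γ t`, and after lowering the index with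
the nondegenerate metric, this reads `g(u'', v) + Γ(u', u'; v) = 0` for all `v`, where `u` is the
coordinate expression of `γ`. -/
def IsGeodesicOn (g : PseudoRiemannianMetric E M) (γ : ℝ → M) (J : Set ℝ) : Prop :=
  ContMDiffOn 𝓘(ℝ, ℝ) 𝓘(ℝ, E) 2 γ J ∧
  ∀ t ∈ J, ∀ v : E,
    let u : ℝ → E := fun s ↦ extChartAt 𝓘(ℝ, E) (γ t) (γ s)
    g.coord (γ t) (u t) (deriv (deriv u) t) v
      + g.christoffel (γ t) (u t) (deriv u t) (deriv u t) v = 0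

end PseudoRiemannianMetric

end Geometry

section Nilmanifold

variable {E : Type*} [NormedAddCommGroup E] [NormedSpace ℝ E]
  {N : Type*} [TopologicalSpace N] [ChartedSpace E N] [Group N] [LieGroup 𝓘(ℝ, E) ∞ N]
  {F : Type*} [NormedAddCommGroup F] [NormedSpace ℝ F]
  {H : Type*} [TopologicalSpace H] [ChartedSpace F H] [Group H] [LieGroup 𝓘(ℝ, F) ∞ H]

/-- The action of `G = N ⋊ H` on the coset space `M = G / H`, which is identified with `N` through
`x ↦ x H`: an element `(a, h)` maps `x` to `a * h(x)`. The isotropy group of `1` is `H`. -/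
def cosetAct {φ : H →* MulAut N} (a : N ⋊[φ] H) (x : N) : N :=
  a.left * φ a.right x

/-- One-parameter subgroups of the Lie group `G = N ⋊ H` (as a manifold, `G = N × H`): the smooth
homomorphisms `ℝ → G`. -/
structure OneParameterSubgroup (E : Type*) [NormedAddCommGroup E] [NormedSpace ℝ E]
    {N : Type*} [TopologicalSpace N] [ChartedSpace E N] [Group N]
    (F : Type*) [NormedAddCommGroup F] [NormedSpace ℝ F]
    {H : Type*} [TopologicalSpace H] [ChartedSpace F H] [Group H]
    (φ : H →* MulAut N) where
  /-- The underlying homomorphism. -/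
  hom : Multiplicative ℝ →* N ⋊[φ] H
  contMDiff_left : ContMDiff 𝓘(ℝ, ℝ) 𝓘(ℝ, E) ∞ fun t : ℝ ↦ (hom (Multiplicative.ofAdd t)).left
  contMDiff_right : ContMDiff 𝓘(ℝ, ℝ) 𝓘(ℝ, F) ∞ fun t : ℝ ↦ (hom (Multiplicative.ofAdd t)).right

/-- The `G`-geodesic orbit property of `M = G / H`, `G = N ⋊ H`: every geodesic is an orbit of a
one-parameter subgroup of `G`, up to a regular change of parameter `θ`. As usual for indefinite
metrics, the affine parameter of the geodesic need not be the parameter of the one-parameter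
subgroup. Only the germ of the geodesic at each of its points is asked to be an orbit: a null
geodesic, extended as far as possible, may be longer than the orbit that it contains. -/
def IsGeodesicOrbit (F : Type*) [NormedAddCommGroup F] [NormedSpace ℝ F]
    {H : Type*} [TopologicalSpace H] [ChartedSpace F H] [Group H]
    (g : PseudoRiemannianMetric E N) (φ : H →* MulAut N) : Prop :=
  ∀ (γ : ℝ → N) (J : Set ℝ), IsOpen J → J.OrdConnected → g.IsGeodesicOn γ J →
    ∀ t₀ ∈ J, ∃ (c : OneParameterSubgroup E F φ) (θ : ℝ → ℝ),
      ContDiffAt ℝ ∞ θ t₀ ∧ θ t₀ = 0 ∧ deriv θ t₀ ≠ 0 ∧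
      ∀ᶠ t in nhds t₀, γ t = cosetAct (c.hom (Multiplicative.ofAdd (θ t))) (γ t₀)

/-- The derived algebra `𝔫' = [𝔫, 𝔫]` of the Lie algebra `𝔫 = T₁N`: the span of all brackets. -/
def derivedAlgebra (E : Type*) [NormedAddCommGroup E] [NormedSpace ℝ E]
    (N : Type*) [TopologicalSpace N] [ChartedSpace E N] [Group N] :
    Submodule ℝ (GroupLieAlgebra 𝓘(ℝ, E) N) :=
  Submodule.span ℝ {Z | ∃ X Y : GroupLieAlgebra 𝓘(ℝ, E) N, ⁅X, Y⁆ = Z}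

/-- The restriction to the derived algebra `𝔫'` of the inner product induced by the metric on
`𝔫 = T₁N` is nondegenerate. -/
def IsNondegenerateOnDerived (g : PseudoRiemannianMetric E N) : Prop :=
  ∀ X ∈ derivedAlgebra E N, (∀ Y ∈ derivedAlgebra E N, g.inner 1 X Y = 0) → X = 0

end Nilmanifold

end

/-! Write $\mathfrak n'$ for the derived algebra and $\mathfrak v$ for its orthogonal complement;
nondegeneracy on $\mathfrak n'$ gives $\mathfrak n=\mathfrak n'\oplus\mathfrak v$.

Infinitesimal form of the hypothesis (`IsGeodesicOrbit.exists_derivation`). Right-invariant fields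
are Killing for a left-invariant metric, so a curve with constant momenta is a geodesic, and the one
with initial velocity $T$ solves a first-order equation. Writing it as an orbit and differentiating
the momenta at time 0 gives, for each $T$, a skew derivation $A$ and a number $k$ with $\langle
T,[T,K]\rangle=\langle AT,K\rangle+k\langle T,K\rangle$ for all $K$. If $T$ is not null, $K=T$
forces $k=0$.

Algebra (`IsGO.two_step`). Testing on $T=X+sY$ with $X\in\mathfrak v$, $Y\in\mathfrak n'$ shows that
$\mathrm{ad}\,X$ is skew on $\mathfrak n'$. It is also nilpotent, and a nilpotent map that is skew
for a positive semidefinite form has image in the radical. If $\mathfrak n'$ is definite, this gives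
$[\mathfrak v,\mathfrak n']=0$. Otherwise $\mathfrak n'$ contains a negative vector and $\mathfrak
v$ has at most one negative direction. For $X\in\mathfrak v$ whose complement in $\mathfrak v$ is
positive semidefinite, the same principle applies to the form $\langle jY,jY'\rangle$ on $\mathfrak
n'$, where $jY\in\mathfrak v$ represents $Z\mapsto\langle Y,[X,Z]\rangle$, and yields
$(\mathrm{ad}\,X)^2=0$ on $\mathfrak v$ (`IsGO.br_br_eq_zero`). Negative $X$ suffice when they
exist, since $(\mathrm{ad}\,X)^2$ is quadratic in $X$; if there are none, $\mathfrak v$ is definite.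
Polarization and the Jacobi identity then kill all triple brackets of $\mathfrak v$, and $\mathfrak
v$ generates $\mathfrak n$ modulo $\mathfrak n'$.

Group and algebra. Nilpotency passes from $N$ to $\mathfrak n$ by differentiating iterated
commutators (`exists_prod_ad_eq_zero`); the bound on the class returns to $N$ by connectedness
(`nilpotencyClass_le_two`). -/

noncomputable section

set_option linter.unusedSectionVars false

/-! ### Semidefinite forms and nilpotent skew maps -/

/-- A null vector of a positive semidefinite form is in the radical. -/
theorem psd_radical {V : Type*} [AddCommGroup V] [Module ℝ V] (S : LinearMap.BilinForm ℝ V)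
    (W : Submodule ℝ V) (hsymm : ∀ x y, S x y = S y x) (hpos : ∀ x ∈ W, 0 ≤ S x x) {u w : V}
    (hu : u ∈ W) (h0 : S u u = 0) (hw : w ∈ W) : S u w = 0 := by
  by_contra hne
  have h1 : ∀ s : ℝ, 0 ≤ 2 * s * S u w + S w w := by
    intro s
    have := hpos (s • u + w) (W.add_mem (W.smul_mem _ hu) hw)
    simp only [map_add, LinearMap.add_apply, map_smul, LinearMap.smul_apply, smul_eq_mul, h0,
      hsymm w u] at this
    linarith
  -- At this value of $s$ the affine function $2sS(u,w)+S(w,w)$ equals $-1$.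
  have h2 := h1 (-(S w w + 1) / (2 * S u w))
  have h3 : 2 * (-(S w w + 1) / (2 * S u w)) * S u w = -(S w w + 1) := by
    field_simp
  linarith

/-- A nilpotent skew map for a positive semidefinite symmetric form has image in the radical. -/
theorem form_map_eq_zero_of_nilpotent {V : Type*} [AddCommGroup V] [Module ℝ V]
    (S : LinearMap.BilinForm ℝ V) (W : Submodule ℝ V) (f : Module.End ℝ V)
    (hsymm : ∀ x y, S x y = S y x) (hpos : ∀ x ∈ W, 0 ≤ S x x) (hf : ∀ x ∈ W, f x ∈ W)
    (hskew : ∀ x ∈ W, S x (f x) = 0) (c : ℕ) (hnil : f ^ c = 0) :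
    ∀ x ∈ W, ∀ y ∈ W, S (f x) y = 0 := by
  have skew : ∀ x ∈ W, ∀ y ∈ W, S (f x) y = - S x (f y) := by
    intro x hx y hy
    have h := hskew (x + y) (W.add_mem hx hy)
    simp only [map_add, LinearMap.add_apply, hskew x hx, hskew y hy] at h
    rw [hsymm (f x) y]; linarith
  have hpow : ∀ m, ∀ x ∈ W, (f ^ m) x ∈ W := by
    intro m
    induction m with
    | zero => intro x hx; simpa using hx
    | succ m ih => intro x hx; rw [pow_succ']; exact hf _ (ih x hx)
  -- Descent on the power: if $f^{m+2}$ has image in the radical, then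
  -- $S(f^{m+1}x,f^{m+1}x)=-S(f^{m+2}x,f^mx)=0$, and a null vector is in the radical, so $f^{m+1}$
  -- has image there too.
  have key : ∀ m, (∀ x ∈ W, ∀ y ∈ W, S ((f ^ (m + 1)) x) y = 0) →
      ∀ x ∈ W, ∀ y ∈ W, S (f x) y = 0 := by
    intro m
    induction m with
    | zero => intro h; simpa using h
    | succ m ih =>
      intro h
      refine ih fun x hx y hy ↦ psd_radical S W hsymm hpos (hpow _ x hx) ?_ hy
      have h1 := skew ((f ^ (m + 1)) x) (hpow _ x hx) ((f ^ m) x) (hpow _ x hx)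
      have h2 : f ((f ^ (m + 1)) x) = (f ^ (m + 1 + 1)) x := by rw [pow_succ' f (m + 1)]; rfl
      have h3 : f ((f ^ m) x) = (f ^ (m + 1)) x := by rw [pow_succ' f m]; rfl
      rw [h2, h3, h x hx _ (hpow _ x hx)] at h1
      linarith
  refine key c fun x _ y _ ↦ ?_
  rw [pow_succ', hnil]; simp

/-! ### Metric Lie algebras -/

/-- A real Lie algebra with a symmetric bilinear form. -/
structure MetricLieAlgebra (V : Type*) [AddCommGroup V] [Module ℝ V] where
  /-- The Lie bracket. -/
  br : V →ₗ[ℝ] Module.End ℝ V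
  /-- The scalar product. -/
  form : LinearMap.BilinForm ℝ V
  br_swap : ∀ x y, br x y = - br y x
  jacobi : ∀ x y z, br x (br y z) = br (br x y) z + br y (br x z)
  symm : ∀ x y, form x y = form y x

namespace MetricLieAlgebra

variable {V : Type*} [AddCommGroup V] [Module ℝ V] (𝔫 : MetricLieAlgebra V)

/-- The derived algebra. -/
def derived : Submodule ℝ V := Submodule.span ℝ {z | ∃ x y, 𝔫.br x y = z}

/-- The orthogonal complement of the derived algebra. -/
def perp : Submodule ℝ V := 𝔫.form.orthogonal 𝔫.derived

/-- The infinitesimal geodesic orbit condition. -/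
def IsGO : Prop := ∀ T, ∃ A : Module.End ℝ V,
  (∀ x y, A (𝔫.br x y) = 𝔫.br (A x) y + 𝔫.br x (A y)) ∧
  (∀ x y, 𝔫.form (A x) y = - 𝔫.form x (A y)) ∧
  ∃ k : ℝ, ∀ K, 𝔫.form T (𝔫.br T K) = 𝔫.form (A T) K + k * 𝔫.form T K

variable {𝔫}

theorem br_self (x : V) : 𝔫.br x x = 0 := by
  have h : (2 : ℝ) • 𝔫.br x x = 0 := by
    rw [two_smul]; exact add_eq_zero_iff_eq_neg.mpr (𝔫.br_swap x x)
  exact (smul_eq_zero.mp h).resolve_left two_ne_zero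

theorem br_mem (x y : V) : 𝔫.br x y ∈ 𝔫.derived := Submodule.subset_span ⟨x, y, rfl⟩

theorem form_perp {x y : V} (hx : x ∈ 𝔫.perp) (hy : y ∈ 𝔫.derived) : 𝔫.form x y = 0 := by
  rw [𝔫.symm]; exact LinearMap.BilinForm.mem_orthogonal_iff.mp hx y hy

theorem form_perp' {x y : V} (hx : x ∈ 𝔫.perp) (hy : y ∈ 𝔫.derived) : 𝔫.form y x = 0 :=
  LinearMap.BilinForm.mem_orthogonal_iff.mp hx y hy

theorem derivation_mem_derived {A : Module.End ℝ V}
    (hA : ∀ x y, A (𝔫.br x y) = 𝔫.br (A x) y + 𝔫.br x (A y)) {x : V} (hx : x ∈ 𝔫.derived) :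
    A x ∈ 𝔫.derived := by
  have : 𝔫.derived ≤ 𝔫.derived.comap A := by
    refine Submodule.span_le.mpr ?_
    rintro _ ⟨x, y, rfl⟩
    change A _ ∈ 𝔫.derived
    rw [hA]
    exact add_mem (br_mem _ _) (br_mem _ _)
  exact this hx

theorem skew_mem_perp {A : Module.End ℝ V}
    (hA : ∀ x y, A (𝔫.br x y) = 𝔫.br (A x) y + 𝔫.br x (A y))
    (hs : ∀ x y, 𝔫.form (A x) y = - 𝔫.form x (A y)) {x : V} (hx : x ∈ 𝔫.perp) :
    A x ∈ 𝔫.perp := by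
  refine LinearMap.BilinForm.mem_orthogonal_iff.mpr fun y hy ↦ ?_
  have := form_perp hx (derivation_mem_derived hA hy)
  rw [𝔫.symm, hs, this, neg_zero]

/-! ### Consequences of the geodesic orbit condition -/

/-- The derivation in the geodesic orbit condition can be chosen with `k = 0` when `T` is not
null. -/
theorem IsGO.exists_of_ne (h : 𝔫.IsGO) {T : V} (hT : 𝔫.form T T ≠ 0) : ∃ A : Module.End ℝ V,
    (∀ x y, A (𝔫.br x y) = 𝔫.br (A x) y + 𝔫.br x (A y)) ∧
    (∀ x y, 𝔫.form (A x) y = - 𝔫.form x (A y)) ∧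
    ∀ K, 𝔫.form T (𝔫.br T K) = 𝔫.form (A T) K := by
  obtain ⟨A, hA, hs, k, hk⟩ := h T
  refine ⟨A, hA, hs, fun K ↦ ?_⟩
  have h1 := hk T
  have h2 := hs T T
  rw [𝔫.symm T (A T)] at h2
  rw [br_self, map_zero, show 𝔫.form (A T) T = 0 by linarith, zero_add] at h1
  have : k = 0 := by
    rcases mul_eq_zero.mp h1.symm with h | h
    · exact h
    · exact absurd h hT
  rw [hk K, this, zero_mul, add_zero]

/-- Supplies a scale $s$ for which $X+sY$ is not null. The condition is even in $s$, so $-s$ is then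
admissible as well. -/
theorem exists_add_sq_ne {a b : ℝ} (h : a ≠ 0 ∨ b ≠ 0) : ∃ s : ℝ, s ≠ 0 ∧ a + s ^ 2 * b ≠ 0 := by
  by_cases h1 : a + b = 0
  · refine ⟨2, by norm_num, fun h2 ↦ ?_⟩
    rcases h with h | h <;> apply h <;> linarith
  · exact ⟨1, one_ne_zero, by simpa using h1⟩

theorem form_add_smul {X Y : V} (hX : X ∈ 𝔫.perp) (hY : Y ∈ 𝔫.derived) (s : ℝ) :
    𝔫.form (X + s • Y) (X + s • Y) = 𝔫.form X X + s ^ 2 * 𝔫.form Y Y := by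
  simp only [map_add, LinearMap.add_apply, map_smul, LinearMap.smul_apply, smul_eq_mul,
    form_perp hX hY, form_perp' hX hY]
  ring

/-- In a geodesic orbit algebra, `ad X` is skew on the derived algebra for `X` orthogonal to it. -/
theorem IsGO.form_br_self (h : 𝔫.IsGO) {X Y : V} (hX : X ∈ 𝔫.perp) (hY : Y ∈ 𝔫.derived) :
    𝔫.form Y (𝔫.br X Y) = 0 := by
  -- Test $T=X+sY$ on $K=Y$. The unwanted term $k\langle T,Y\rangle=ks\langle Y,Y\rangle$ vanishes
  -- when $Y$ is null, so $s=1$ will do; otherwise $s$ is chosen with $T$ not null, and then $k=0$.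
  by_cases hYY : 𝔫.form Y Y = 0
  · obtain ⟨A, hA, hs, k, hk⟩ := h (X + Y)
    have h1 := hk Y
    have h2 := hs Y Y
    rw [𝔫.symm Y (A Y)] at h2
    simp only [map_add, LinearMap.add_apply, br_self, form_perp hX (br_mem _ _),
      form_perp (skew_mem_perp hA hs hX) hY, form_perp hX hY, hYY, map_zero] at h1
    linarith
  · obtain ⟨s, hs0, hs1⟩ := exists_add_sq_ne (a := 𝔫.form X X) (Or.inr hYY)
    rw [← form_add_smul hX hY] at hs1
    obtain ⟨A, hA, hs, hk⟩ := h.exists_of_ne hs1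
    have h1 := hk Y
    have h2 := hs Y Y
    rw [𝔫.symm Y (A Y)] at h2
    simp only [map_add, LinearMap.add_apply, br_self, form_perp hX (br_mem _ _), map_smul,
      LinearMap.smul_apply, smul_eq_mul, smul_zero,
      form_perp (skew_mem_perp hA hs hX) hY, map_zero] at h1
    have h3 : s * 𝔫.form Y (𝔫.br X Y) = 0 := by
      rw [show 𝔫.form (A Y) Y = 0 by linarith] at h1; linarith
    exact (mul_eq_zero.mp h3).resolve_left hs0

theorem IsGO.form_br (h : 𝔫.IsGO) {X Y Z : V} (hX : X ∈ 𝔫.perp) (hY : Y ∈ 𝔫.derived)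
    (hZ : Z ∈ 𝔫.derived) : 𝔫.form Y (𝔫.br X Z) = - 𝔫.form (𝔫.br X Y) Z := by
  have h1 := h.form_br_self hX (add_mem hY hZ)
  simp only [map_add, LinearMap.add_apply, h.form_br_self hX hY, h.form_br_self hX hZ] at h1
  rw [𝔫.symm (𝔫.br X Y) Z]; linarith

/-- The operators `J_Y X`, which represent the `Y`-component of the bracket on the complement of the
derived algebra, exist and depend linearly on `Y`. -/
theorem exists_representing [FiniteDimensional ℝ V] (hnd : 𝔫.form.Nondegenerate)
    (hc : IsCompl 𝔫.derived 𝔫.perp) (X : V) : ∃ j : Module.End ℝ V, (∀ Y, j Y ∈ 𝔫.perp) ∧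
      ∀ Y, ∀ Z ∈ 𝔫.perp, 𝔫.form (j Y) Z = 𝔫.form Y (𝔫.br X Z) := by
  refine ⟨(𝔫.perp.projection 𝔫.derived hc.symm) ∘ₗ
    (𝔫.form.leftAdjointOfNondegenerate hnd (𝔫.br X)), fun Y ↦ ?_, fun Y Z hZ ↦ ?_⟩
  · exact Submodule.projection_apply_mem _ _
  · have h1 := 𝔫.form.isAdjointPairLeftAdjointOfNondegenerate hnd (𝔫.br X) Y Z
    rw [← h1]
    set U := 𝔫.form.leftAdjointOfNondegenerate hnd (𝔫.br X) Y with hU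
    -- The part of the adjoint removed by the projection lies in the derived algebra, so pairing
    -- with its complement does not see it.
    have h2 : U - 𝔫.perp.projection 𝔫.derived hc.symm U ∈ 𝔫.derived := by
      have h3 := Submodule.projection_add_projection_eq_self hc.symm U
      have h4 : U - 𝔫.perp.projection 𝔫.derived hc.symm U = 𝔫.derived.projection 𝔫.perp hc U := by
        rw [sub_eq_iff_eq_add, add_comm]; exact h3.symm
      rw [h4]; exact Submodule.projection_apply_mem _ _
    have h5 := form_perp' hZ h2
    rw [map_sub, LinearMap.sub_apply, sub_eq_zero] at h5
    exact h5.symm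

theorem eq_of_mem_perp (hnd : 𝔫.form.Nondegenerate) (hc : IsCompl 𝔫.derived 𝔫.perp) {U U' : V}
    (hU : U ∈ 𝔫.perp) (hU' : U' ∈ 𝔫.perp) (h : ∀ Z ∈ 𝔫.perp, 𝔫.form U Z = 𝔫.form U' Z) :
    U = U' := by
  rw [← sub_eq_zero]
  refine hnd.1 _ fun Z ↦ ?_
  have hZ : Z ∈ 𝔫.derived ⊔ 𝔫.perp := by rw [hc.sup_eq_top]; trivial
  obtain ⟨a, ha, b, hb, rfl⟩ := Submodule.mem_sup.mp hZ
  rw [map_add, form_perp (sub_mem hU hU') ha, zero_add, map_sub, LinearMap.sub_apply, h b hb,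
    sub_self]

/-- Take $T=X+sY$ not null, with its derivation $A$. Testing on the complement gives $AX=s\,jY$.
Testing on $K=[X,jY]$, the term $\langle AY,K\rangle=-\langle Y,[s\,jY,jY]+[X,A\,jY]\rangle=-\langle
jY,A\,jY\rangle$ vanishes by skewness. What remains is $\langle Y,[X,K]\rangle+s\langle
Y,[Y,K]\rangle=0$, and comparison of $s$ with $-s$ isolates the first term. -/
theorem IsGO.form_br_br_representing (h : 𝔫.IsGO) (hnd : 𝔫.form.Nondegenerate)
    (hc : IsCompl 𝔫.derived 𝔫.perp) {X Y : V} (hX : X ∈ 𝔫.perp) (hY : Y ∈ 𝔫.derived)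
    (hXX : 𝔫.form X X ≠ 0) {j : Module.End ℝ V} (hj : ∀ Y, j Y ∈ 𝔫.perp)
    (hj' : ∀ Y, ∀ Z ∈ 𝔫.perp, 𝔫.form (j Y) Z = 𝔫.form Y (𝔫.br X Z)) :
    𝔫.form Y (𝔫.br X (𝔫.br X (j Y))) = 0 := by
  have aux : ∀ s : ℝ, s ≠ 0 → 𝔫.form X X + s ^ 2 * 𝔫.form Y Y ≠ 0 →
      𝔫.form Y (𝔫.br X (𝔫.br X (j Y))) + s * 𝔫.form Y (𝔫.br Y (𝔫.br X (j Y))) = 0 := by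
    intro s hs0 hs1
    rw [← form_add_smul hX hY] at hs1
    obtain ⟨A, hA, hs, hk⟩ := h.exists_of_ne hs1
    have hAX : A X = s • j Y := by
      refine eq_of_mem_perp hnd hc (skew_mem_perp hA hs hX) (Submodule.smul_mem _ _ (hj Y)) ?_
      intro Z hZ
      have h1 := hk Z
      have h2 : 𝔫.form Y (𝔫.br Y Z) = 0 := by
        rw [𝔫.br_swap, map_neg, h.form_br_self hZ hY, neg_zero]
      have h3 : 𝔫.form (A Y) Z = 0 := form_perp' hZ (derivation_mem_derived hA hY)
      simp only [map_add, LinearMap.add_apply, map_smul, LinearMap.smul_apply, smul_eq_mul,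
        form_perp hX (br_mem _ _), h2, h3] at h1
      rw [map_smul, LinearMap.smul_apply, smul_eq_mul, hj' Y Z hZ]
      linarith
    have h1 := hk (𝔫.br X (j Y))
    have h2 : 𝔫.form (A Y) (𝔫.br X (j Y)) = 0 := by
      have h3 : 𝔫.form (j Y) (A (j Y)) = 0 := by
        have := hs (j Y) (j Y)
        rw [𝔫.symm (A (j Y))] at this; linarith
      rw [hs, hA, hAX, map_smul, LinearMap.smul_apply, br_self, smul_zero, zero_add,
        ← hj' Y _ (skew_mem_perp hA hs (hj Y)), h3, neg_zero]
    simp only [map_add, LinearMap.add_apply, map_smul, LinearMap.smul_apply, smul_eq_mul,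
        form_perp hX (br_mem _ _), h2, form_perp (skew_mem_perp hA hs hX) (br_mem _ _)] at h1
    have h4 : s * (𝔫.form Y (𝔫.br X (𝔫.br X (j Y)))
        + s * 𝔫.form Y (𝔫.br Y (𝔫.br X (j Y)))) = 0 := by linarith
    exact (mul_eq_zero.mp h4).resolve_left hs0
  obtain ⟨s, hs0, hs1⟩ := exists_add_sq_ne (b := 𝔫.form Y Y) (Or.inl hXX)
  have h1 := aux s hs0 hs1
  have h2 := aux (-s) (neg_ne_zero.mpr hs0) (by rwa [neg_sq])
  linarith

/-- If the form is positive semidefinite on the orthogonal complement of a non-null `X` in the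
complement of the derived algebra, then `(ad X)²` vanishes on that complement. -/
theorem IsGO.br_br_eq_zero [FiniteDimensional ℝ V] (h : 𝔫.IsGO) (hnd : 𝔫.form.Nondegenerate)
    (hc : IsCompl 𝔫.derived 𝔫.perp) {X : V} (hX : X ∈ 𝔫.perp) (hXX : 𝔫.form X X ≠ 0)
    (hpos : ∀ U ∈ 𝔫.perp, 𝔫.form X U = 0 → 0 ≤ 𝔫.form U U) {c : ℕ} (hnil : (𝔫.br X) ^ c = 0) :
    ∀ Z ∈ 𝔫.perp, 𝔫.br X (𝔫.br X Z) = 0 := by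
  obtain ⟨j, hj, hj'⟩ := exists_representing hnd hc X
  have hjX : ∀ Y, 𝔫.form (j Y) X = 0 := fun Y ↦ by rw [hj' Y X hX, br_self, map_zero]
  -- The form is $S(Y,Y')=\langle jY,jY'\rangle$. It is semidefinite because $\langle
  -- jY,X\rangle=\langle Y,[X,X]\rangle=0$, and $\mathrm{ad}\,X$ is $S$-skew because
  -- $S(Y,[X,Y])=\langle[X,Y],[X,jY]\rangle=-\langle Y,[X,[X,jY]]\rangle=0$.
  have key := form_map_eq_zero_of_nilpotent (𝔫.form.compl₁₂ j j) 𝔫.derived (𝔫.br X)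
    (fun x y ↦ 𝔫.symm _ _) (fun x _ ↦ hpos _ (hj x) (by rw [𝔫.symm, hjX])) (fun x _ ↦ br_mem _ _)
    (fun x hx ↦ by
      change 𝔫.form (j x) (j (𝔫.br X x)) = 0
      rw [𝔫.symm, hj' _ _ (hj x)]
      have h1 := h.form_br hX hx (br_mem X (j x))
      rw [h.form_br_br_representing hnd hc hX hx hXX hj hj'] at h1
      linarith) c hnil
  -- `J_{[X, Y]} X` is orthogonal to everything of the form `J_Y' X`.
  have key2 : ∀ Y ∈ 𝔫.derived, 𝔫.form (j (𝔫.br X Y)) (j (𝔫.br X Y)) = 0 :=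
    fun Y hY ↦ key Y hY _ (br_mem _ _)
  have rad : ∀ U ∈ 𝔫.perp, 𝔫.form X U = 0 → 𝔫.form U U = 0 → ∀ Z ∈ 𝔫.perp, 𝔫.form X Z = 0 →
      𝔫.form U Z = 0 := fun u hu hu0 h0 w hw hw0 ↦
    psd_radical 𝔫.form (𝔫.perp ⊓ LinearMap.ker (𝔫.form X)) 𝔫.symm (fun U hU ↦ hpos U hU.1 hU.2)
      ⟨hu, hu0⟩ h0 ⟨hw, hw0⟩
  have key3 : ∀ Y ∈ 𝔫.derived, ∀ Z ∈ 𝔫.perp, 𝔫.form (j (𝔫.br X Y)) Z = 0 := by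
    -- Semidefiniteness controls only the part of $Z$ orthogonal to $X$; its $X$-component is
    -- harmless because $j$ takes values orthogonal to $X$.
    intro Y hY Z hZ
    set a := 𝔫.form X Z / 𝔫.form X X with ha
    have h1 := rad _ (hj (𝔫.br X Y)) (by rw [𝔫.symm, hjX]) (key2 Y hY) (Z - a • X)
      (sub_mem hZ (Submodule.smul_mem _ _ hX)) (by
        rw [map_sub, map_smul, smul_eq_mul, ha, div_mul_cancel₀ _ hXX, sub_self])
    rwa [map_sub, map_smul, hjX, smul_zero, sub_zero] at h1
  intro Z hZ
  -- For $a\in\mathfrak n'$: $\langle a,[X,[X,Z]]\rangle=-\langle[X,a],[X,Z]\rangle=-\langle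
  -- j[X,a],Z\rangle=0$.
  refine hnd.2 _ fun Y ↦ ?_
  have hY : Y ∈ 𝔫.derived ⊔ 𝔫.perp := by rw [hc.sup_eq_top]; trivial
  obtain ⟨a, ha, b, hb, rfl⟩ := Submodule.mem_sup.mp hY
  rw [map_add, LinearMap.add_apply, form_perp hb (br_mem _ _), add_zero,
    h.form_br hX ha (br_mem _ _), ← hj' _ _ hZ, key3 a ha Z hZ, neg_zero]

/-! ### Lower central series and triple brackets -/

variable (𝔫) in
/-- The terms of the lower central series: spans of iterated brackets. -/
def series : ℕ → Submodule ℝ V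
  | 0 => ⊤
  | k + 1 => Submodule.span ℝ {z | ∃ x, ∃ y ∈ series k, 𝔫.br x y = z}

theorem br_mem_series {k : ℕ} (x : V) {y : V} (hy : y ∈ 𝔫.series k) :
    𝔫.br x y ∈ 𝔫.series (k + 1) :=
  Submodule.subset_span ⟨x, y, hy, rfl⟩

theorem series_one : 𝔫.series 1 = 𝔫.derived := by
  simp [series, derived]

theorem series_mono {k l : ℕ} (h : 𝔫.series k ≤ 𝔫.series l) :
    𝔫.series (k + 1) ≤ 𝔫.series (l + 1) :=
  Submodule.span_mono fun _ ⟨x, y, hy, hz⟩ ↦ ⟨x, y, h hy, hz⟩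

/-- Each term of the series absorbs one factor $\mathrm{ad}\,x$: products of $c-k$ factors kill the
$k$-th term, and at $k=c$ the product is empty. -/
theorem series_eq_bot {c : ℕ} (hnil : ∀ l : List V, l.length = c → (l.map 𝔫.br).prod = 0) :
    𝔫.series c = ⊥ := by
  have key : ∀ k, ∀ l : List V, l.length + k = c → ∀ z ∈ 𝔫.series k, (l.map 𝔫.br).prod z = 0 := by
    intro k
    induction k with
    | zero => intro l hl z _; rw [hnil l (by simpa using hl)]; rfl
    | succ k ih =>
      intro l hl z hz
      have : 𝔫.series (k + 1) ≤ LinearMap.ker (l.map 𝔫.br).prod := by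
        refine Submodule.span_le.mpr ?_
        rintro _ ⟨x, y, hy, rfl⟩
        have h1 := ih (l ++ [x]) (by simp; omega) y hy
        simpa using h1
      exact this hz
  rw [eq_bot_iff]
  intro z hz
  simpa using key c [] (by simp) z hz

/-- If all triple brackets of elements of a complement of the derived algebra vanish, then the
nilpotent Lie algebra is at most 2-step. -/
theorem br_br_eq_zero_of_perp (hsup : 𝔫.derived ⊔ 𝔫.perp = ⊤) {c : ℕ}
    (hnil : ∀ l : List V, l.length = c → (l.map 𝔫.br).prod = 0)
    (h : ∀ x ∈ 𝔫.perp, ∀ y ∈ 𝔫.perp, ∀ z ∈ 𝔫.perp, 𝔫.br x (𝔫.br y z) = 0) (x y z : V) :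
    𝔫.br x (𝔫.br y z) = 0 := by
  have h1 : ∀ w ∈ 𝔫.derived, w ∈ 𝔫.series 1 := fun w hw ↦ by rwa [series_one]
  have hsw : ∀ {k : ℕ} (x : V) {y : V}, y ∈ 𝔫.series k → 𝔫.br y x ∈ 𝔫.series (k + 1) := by
    intro k x y hy
    rw [𝔫.br_swap]
    exact neg_mem (br_mem_series x hy)
  -- The series is numbered from `series 0 = ⊤`, so triple brackets lie in `series 2`. The aim is
  -- `series 2 ≤ series 3`, after which the series is stationary from there on.
  have hWW : ∀ w ∈ 𝔫.derived, ∀ w' ∈ 𝔫.derived, 𝔫.br w w' ∈ 𝔫.series 3 := by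
    intro w hw w' hw'
    have : 𝔫.derived ≤ (𝔫.series 3).comap (𝔫.br.flip w') := by
      refine Submodule.span_le.mpr ?_
      rintro _ ⟨p, q, rfl⟩
      change 𝔫.br (𝔫.br p q) w' ∈ 𝔫.series 3
      rw [show 𝔫.br (𝔫.br p q) w' = 𝔫.br p (𝔫.br q w') - 𝔫.br q (𝔫.br p w') by
        rw [𝔫.jacobi p q w']; abel]
      exact sub_mem (br_mem_series _ (br_mem_series _ (h1 _ hw')))
        (br_mem_series _ (br_mem_series _ (h1 _ hw')))
    exact this hw
  have hdec : ∀ u : V, ∃ a ∈ 𝔫.derived, ∃ b ∈ 𝔫.perp, a + b = u := by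
    intro u
    exact Submodule.mem_sup.mp (by rw [hsup]; trivial)
  have hVW : ∀ v ∈ 𝔫.perp, ∀ w ∈ 𝔫.derived, 𝔫.br v w ∈ 𝔫.series 3 := by
    intro v hv w hw
    have : 𝔫.derived ≤ (𝔫.series 3).comap (𝔫.br v) := by
      refine Submodule.span_le.mpr ?_
      rintro _ ⟨p, q, rfl⟩
      change 𝔫.br v (𝔫.br p q) ∈ 𝔫.series 3
      obtain ⟨a, ha, b, hb, rfl⟩ := hdec p
      obtain ⟨a', ha', b', hb', rfl⟩ := hdec q
      simp only [map_add, LinearMap.add_apply, h v hv b hb b' hb', add_zero]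
      exact add_mem (add_mem (br_mem_series _ (hsw _ (h1 _ ha)))
        (br_mem_series _ (br_mem_series _ (h1 _ ha')))) (br_mem_series _ (hsw _ (h1 _ ha)))
    exact this hw
  have h23 : 𝔫.series 2 ≤ 𝔫.series 3 := by
    refine Submodule.span_le.mpr ?_
    rintro _ ⟨p, q, hq, rfl⟩
    rw [series_one] at hq
    obtain ⟨a, ha, b, hb, rfl⟩ := hdec p
    rw [map_add, LinearMap.add_apply]
    exact add_mem (hWW a ha q hq) (hVW b hb q hq)
  have hstep : ∀ k, 𝔫.series (k + 2) ≤ 𝔫.series (k + 3) := by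
    intro k
    induction k with
    | zero => exact h23
    | succ k ih => exact series_mono ih
  have hall : ∀ k, 𝔫.series 2 ≤ 𝔫.series (k + 2) := by
    intro k
    induction k with
    | zero => exact le_rfl
    | succ k ih => exact ih.trans (hstep k)
  have hanti : ∀ k, 𝔫.series (k + 1) ≤ 𝔫.series k := by
    intro k
    induction k with
    | zero => exact le_top
    | succ k ih => exact series_mono ih
  -- Going up to index $c+2$ and back down to $c$ avoids separating the cases $c<2$.
  have hbot : 𝔫.series 2 ≤ ⊥ := by
    rw [← series_eq_bot hnil]
    exact (hall c).trans ((hanti (c + 1)).trans (hanti c))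
  exact (Submodule.mem_bot ℝ).mp (hbot (br_mem_series _ (br_mem_series _ Submodule.mem_top)))

/-- Polarization makes $[x,[y,z]]$ antisymmetric in $x,y$; it is antisymmetric in $y,z$ anyway. For
such an alternating expression the Jacobi identity reads $3[x,[y,z]]=0$. -/
theorem triple_eq_zero_of_sq
    (h : ∀ x ∈ 𝔫.perp, ∀ z ∈ 𝔫.perp, 𝔫.br x (𝔫.br x z) = 0) :
    ∀ x ∈ 𝔫.perp, ∀ y ∈ 𝔫.perp, ∀ z ∈ 𝔫.perp, 𝔫.br x (𝔫.br y z) = 0 := by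
  have hpol : ∀ x ∈ 𝔫.perp, ∀ y ∈ 𝔫.perp, ∀ z ∈ 𝔫.perp,
      𝔫.br x (𝔫.br y z) = - 𝔫.br y (𝔫.br x z) := by
    intro x hx y hy z hz
    have h1 := h (x + y) (add_mem hx hy) z hz
    simp only [map_add, LinearMap.add_apply, h x hx z hz, h y hy z hz, zero_add, add_zero] at h1
    exact eq_neg_of_add_eq_zero_right h1
  intro x hx y hy z hz
  have h1 := 𝔫.jacobi x y z
  have h2 : 𝔫.br (𝔫.br x y) z = - 𝔫.br x (𝔫.br y z) := by
    rw [𝔫.br_swap, hpol z hz x hx y hy, neg_neg, 𝔫.br_swap z y, map_neg]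
  rw [h2, hpol y hy x hx z hz] at h1
  have h3 : (3 : ℝ) • 𝔫.br x (𝔫.br y z) = 0 := by
    linear_combination (norm := module) h1
  exact (smul_eq_zero.mp h3).resolve_left (by norm_num)

/-- The expression is a quadratic polynomial in $s$. Its value at $s=0$ is recovered by Lagrange
interpolation from the nodes $t,t+1,t+2$, all in the range where it vanishes. -/
theorem br_br_eq_zero_of_large {x x₀ z : V}
    (h : ∃ r : ℝ, ∀ s ≥ r, 𝔫.br (x + s • x₀) (𝔫.br (x + s • x₀) z) = 0) :
    𝔫.br x (𝔫.br x z) = 0 := by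
  obtain ⟨r, hr⟩ := h
  have h0 := hr (max r 1) (le_max_left _ _)
  have h1 := hr (max r 1 + 1) (by linarith [le_max_left r 1])
  have h2 := hr (max r 1 + 2) (by linarith [le_max_left r 1])
  set t := max r 1
  simp only [map_add, LinearMap.add_apply, map_smul, LinearMap.smul_apply] at h0 h1 h2
  have h3 : (2 : ℝ) • 𝔫.br x (𝔫.br x z) = 0 := by
    linear_combination (norm := module) ((t + 1) * (t + 2)) • h0 - (2 * t * (t + 2)) • h1
      + (t * (t + 1)) • h2
  exact (smul_eq_zero.mp h3).resolve_left (by norm_num)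

/-! ### Distribution of the negative directions -/

/-- A nilpotent geodesic orbit algebra with a form of index at most two, nondegenerate on the
derived algebra, is at most 2-step nilpotent. -/
theorem IsGO.two_step [FiniteDimensional ℝ V] (h : 𝔫.IsGO) (hnd : 𝔫.form.Nondegenerate)
    (hder : ∀ x ∈ 𝔫.derived, (∀ y ∈ 𝔫.derived, 𝔫.form x y = 0) → x = 0)
    (hneg : ∀ x y z, 𝔫.form x x < 0 → 𝔫.form y y < 0 → 𝔫.form x y = 0 → 𝔫.form x z = 0 →
      𝔫.form y z = 0 → 0 ≤ 𝔫.form z z) {c : ℕ}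
    (hnil : ∀ l : List V, l.length = c → (l.map 𝔫.br).prod = 0) (x y z : V) :
    𝔫.br x (𝔫.br y z) = 0 := by
  have hsymm : 𝔫.form.IsSymm := ⟨fun x y ↦ 𝔫.symm x y⟩
  have hc : IsCompl 𝔫.derived 𝔫.perp := by
    refine LinearMap.BilinForm.isCompl_orthogonal_of_restrict_nondegenerate hsymm.isRefl ⟨?_, ?_⟩
    · intro x hx
      exact Subtype.ext (hder x x.2 fun y hy ↦ hx ⟨y, hy⟩)
    · intro x hx
      exact Subtype.ext (hder x x.2 fun y hy ↦ by rw [𝔫.symm]; exact hx ⟨y, hy⟩)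
  have hnilx : ∀ x, (𝔫.br x) ^ c = 0 := by
    intro x
    simpa using hnil (List.replicate c x) (by simp)
  refine br_br_eq_zero_of_perp hc.sup_eq_top hnil ?_ x y z
  -- If the derived algebra carries no negative vector, the skew nilpotent map $\mathrm{ad}\,v$ has
  -- image in its radical, which is zero, whatever the signature on the complement.
  by_cases hW : ∀ Y ∈ 𝔫.derived, 0 ≤ 𝔫.form Y Y
  · intro v hv y _ z _
    have h1 := form_map_eq_zero_of_nilpotent 𝔫.form 𝔫.derived (𝔫.br v) 𝔫.symm hW
      (fun x _ ↦ br_mem _ _) (fun x hx ↦ h.form_br_self hv hx) c (hnilx v)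
    exact hder _ (br_mem _ _) fun w hw ↦ h1 _ (br_mem _ _) w hw
  · push Not at hW
    obtain ⟨Y₀, hY₀, hneg₀⟩ := hW
    apply triple_eq_zero_of_sq
    -- The vectors $Y_0$ and $X$ use up both negative directions, so nothing negative in the
    -- complement is orthogonal to $X$.
    have htime : ∀ X ∈ 𝔫.perp, 𝔫.form X X < 0 → ∀ Z ∈ 𝔫.perp, 𝔫.br X (𝔫.br X Z) = 0 :=
      fun X hX hXX ↦ h.br_br_eq_zero hnd hc hX hXX.ne (fun U hU hXU ↦ hneg Y₀ X U hneg₀ hXX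
        (form_perp' hX hY₀) (form_perp' hU hY₀) hXU) (hnilx X)
    by_cases hv : ∃ X₀ ∈ 𝔫.perp, 𝔫.form X₀ X₀ < 0
    · obtain ⟨X₀, hX₀, hX₀neg⟩ := hv
      intro X hX Z hZ
      refine br_br_eq_zero_of_large (x₀ := X₀) ?_
      set a := 𝔫.form X X
      set b := 𝔫.form X X₀ with hb
      set d := 𝔫.form X₀ X₀
      -- Here $s\ge1$ and $-sd\ge|a|+2|b|+1$, so $-s^2d$ dominates $a+2sb$ and $X+sX_0$ is negative.
      refine ⟨max 1 ((|a| + 2 * |b| + 1) / (-d)), fun s hs ↦ ?_⟩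
      refine htime _ (add_mem hX (Submodule.smul_mem _ _ hX₀)) ?_ Z hZ
      have e : 𝔫.form (X + s • X₀) (X + s • X₀) = a + 2 * s * b + s ^ 2 * d := by
        simp only [map_add, LinearMap.add_apply, map_smul, LinearMap.smul_apply, smul_eq_mul,
          𝔫.symm X₀ X, ← hb]
        ring
      rw [e]
      have h1 : 1 ≤ s := (le_max_left _ _).trans hs
      have h2 : (|a| + 2 * |b| + 1) / (-d) ≤ s := (le_max_right _ _).trans hs
      rw [div_le_iff₀ (by linarith)] at h2
      have h3 := le_abs_self a
      have h4 := le_abs_self b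
      have h5 : s * (|a| + 2 * |b| + 1) ≤ s * (s * (-d)) :=
        mul_le_mul_of_nonneg_left h2 (by linarith)
      have h6 : |a| ≤ s * |a| := le_mul_of_one_le_left (abs_nonneg a) h1
      have h7 : s * b ≤ s * |b| := mul_le_mul_of_nonneg_left h4 (by linarith)
      nlinarith
    · push Not at hv
      intro X hX Z hZ
      -- The form is now semidefinite and nondegenerate on the complement, so its only null vector
      -- is 0.
      by_cases hXX : 𝔫.form X X = 0
      · have h0 : X = 0 := by
          refine eq_of_mem_perp hnd hc hX (zero_mem _) fun w hw ↦ ?_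
          rw [map_zero, LinearMap.zero_apply]
          exact psd_radical 𝔫.form 𝔫.perp 𝔫.symm hv hX hXX hw
        rw [h0]; simp
      · exact h.br_br_eq_zero hnd hc hX hXX (fun U hU _ ↦ hv U hU) (hnilx X) Z hZ

end MetricLieAlgebra

/-! ### Noether's conservation law and partial derivatives in coordinates -/

section Calculus

open Filter Topology

variable {E : Type*} [NormedAddCommGroup E] [NormedSpace ℝ E]
  {P : Type*} [NormedAddCommGroup P] [NormedSpace ℝ P]
  {F : Type*} [NormedAddCommGroup F] [NormedSpace ℝ F]

theorem DifferentiableAt.hasDerivAt_comp_of_eq {B : E → F} {y : E} (hB : DifferentiableAt ℝ B y)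
    {u : ℝ → E} {u' : E} {t : ℝ} (hu : HasDerivAt u u' t) (h : u t = y) :
    HasDerivAt (fun s ↦ B (u s)) (fderiv ℝ B y u') t :=
  hB.hasFDerivAt.comp_hasDerivAt_of_eq t hu h.symm

set_option synthInstance.maxHeartbeats 200000 in
/-- The Noether conservation law in coordinates: if a family of local isometries `Φ z` of the metric
`B` generates the vector field `k`, then conservation of the momentum `B(u', k)` along the curve `u`
is the `k`-component of the geodesic equation. -/
theorem geodesic_equation_of_momentum {Φ : P × E → E} {z₀ : P} {y₀ : E}
    (hΦ : ContDiffAt ℝ ∞ Φ (z₀, y₀)) (hid : ∀ᶠ y in 𝓝 y₀, Φ (z₀, y) = y)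
    {B : E → E →L[ℝ] E →L[ℝ] ℝ} (hB : DifferentiableAt ℝ B y₀)
    (hsymm : ∀ v w, B y₀ v w = B y₀ w v)
    (hiso : ∀ᶠ z in 𝓝 z₀, ∀ a, B (Φ (z, y₀)) (fderiv ℝ Φ (z, y₀) (0, a))
      (fderiv ℝ Φ (z, y₀) (0, a)) = B y₀ a a)
    (K : P) {u : ℝ → E} {t : ℝ} (hu : ContDiffAt ℝ 2 u t) (hut : u t = y₀) {μ : ℝ}
    (hcons : ∀ᶠ s in 𝓝 t, B (u s) (deriv u s) (fderiv ℝ Φ (z₀, u s) (K, 0)) = μ) :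
    B y₀ (deriv (deriv u) t) (fderiv ℝ Φ (z₀, y₀) (K, 0))
      + (fderiv ℝ B y₀ (deriv u t) (deriv u t) (fderiv ℝ Φ (z₀, y₀) (K, 0))
        + fderiv ℝ B y₀ (deriv u t) (deriv u t) (fderiv ℝ Φ (z₀, y₀) (K, 0))
        - fderiv ℝ B y₀ (fderiv ℝ Φ (z₀, y₀) (K, 0)) (deriv u t) (deriv u t)) / 2 = 0 := by
  set k := fderiv ℝ Φ (z₀, y₀) (K, 0) with hk
  set a := deriv u t with ha
  have hΦd : HasFDerivAt Φ (fderiv ℝ Φ (z₀, y₀)) (z₀, y₀) :=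
    (hΦ.differentiableAt (by simp)).hasFDerivAt
  have hΦ' : DifferentiableAt ℝ (fderiv ℝ Φ) (z₀, y₀) :=
    (hΦ.fderiv_right (m := 1) (by norm_cast)).differentiableAt (by simp)
  set D2 := fderiv ℝ (fderiv ℝ Φ) (z₀, y₀) with hD2
  have hsym2 : D2 (K, 0) (0, a) = D2 (0, a) (K, 0) := by
    exact hΦ.isSymmSndFDerivAt (by simp only [minSmoothness_of_isRCLikeNormedField]; exact WithTop.coe_le_coe.mpr le_top) _ _
  have hΦ0 : Φ (z₀, y₀) = y₀ := hid.self_of_nhds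
  have ha0 : fderiv ℝ Φ (z₀, y₀) (0, a) = a := by
    have h1 : HasFDerivAt (fun y ↦ Φ (z₀, y))
        ((fderiv ℝ Φ (z₀, y₀)).comp (ContinuousLinearMap.inr ℝ P E)) y₀ :=
      hΦd.comp y₀ (hasFDerivAt_prodMk_right z₀ y₀)
    have h2 : HasFDerivAt (fun y ↦ Φ (z₀, y)) (ContinuousLinearMap.id ℝ E) y₀ :=
      (hasFDerivAt_id y₀).congr_of_eventuallyEq hid
    simpa using DFunLike.congr_fun (h1.unique h2) a
  -- variation of the energy along the group
  have hline : HasDerivAt (fun s : ℝ ↦ ((z₀ + s • K, y₀) : P × E)) (K, 0) 0 := by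
    have h1 : HasDerivAt (fun s : ℝ ↦ z₀ + s • K) K 0 := by
      simpa using ((hasDerivAt_id (0 : ℝ)).smul_const K).const_add z₀
    exact h1.prodMk (hasDerivAt_const 0 y₀)
  have hline0 : ((z₀ + (0 : ℝ) • K, y₀) : P × E) = (z₀, y₀) := by simp
  have e1 : HasDerivAt (fun s : ℝ ↦ Φ (z₀ + s • K, y₀)) k 0 := by
    have h1 : HasFDerivAt Φ (fderiv ℝ Φ (z₀, y₀)) ((fun s : ℝ ↦ ((z₀ + s • K, y₀) : P × E)) 0) := by
      simpa using hΦd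
    exact h1.comp_hasDerivAt 0 hline
  have e2 := DifferentiableAt.hasDerivAt_comp_of_eq (F := E →L[ℝ] E →L[ℝ] ℝ) hB e1 ((congrArg Φ hline0).trans hΦ0)
  have e3 : HasDerivAt (fun s : ℝ ↦ fderiv ℝ Φ (z₀ + s • K, y₀)) (D2 (K, 0)) 0 := by
    have h1 : HasFDerivAt (fderiv ℝ Φ) D2 ((fun s : ℝ ↦ ((z₀ + s • K, y₀) : P × E)) 0) := by
      simpa using hΦ'.hasFDerivAt
    exact h1.comp_hasDerivAt 0 hline
  have e4 : HasDerivAt (fun s : ℝ ↦ fderiv ℝ Φ (z₀ + s • K, y₀) (0, a)) (D2 (K, 0) (0, a)) 0 := by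
    simpa using e3.clm_apply (hasDerivAt_const 0 ((0 : P), a))
  have e5 := (e2.clm_apply e4).clm_apply e4
  have e6 : HasDerivAt (fun s : ℝ ↦ B (Φ (z₀ + s • K, y₀)) (fderiv ℝ Φ (z₀ + s • K, y₀) (0, a))
      (fderiv ℝ Φ (z₀ + s • K, y₀) (0, a))) 0 0 := by
    refine (hasDerivAt_const 0 (B y₀ a a)).congr_of_eventuallyEq ?_
    have hc : Tendsto (fun s : ℝ ↦ z₀ + s • K) (𝓝 0) (𝓝 z₀) := by
      have : ContinuousAt (fun s : ℝ ↦ z₀ + s • K) 0 := by fun_prop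
      simpa [ContinuousAt] using this
    filter_upwards [hc.eventually hiso] with s hs using hs a
  have r1 := e5.unique e6
  simp only [zero_smul, add_zero, hΦ0, ha0, add_apply] at r1
  -- conservation of momentum along the curve
  have hu1 : HasDerivAt u a t := (hu.differentiableAt (by simp)).hasDerivAt
  have hu2 : HasDerivAt (deriv u) (deriv (deriv u) t) t := by
    have h1 : ContDiffAt ℝ 1 (deriv u) t := by
      have h2 : ContDiffAt ℝ 1 (fderiv ℝ u) t := hu.fderiv_right (by norm_num)
      exact h2.clm_apply contDiffAt_const
    exact (h1.differentiableAt (by simp)).hasDerivAt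
  have hline' : HasDerivAt (fun s : ℝ ↦ ((z₀, u s) : P × E)) (0, a) t :=
    (hasDerivAt_const t z₀).prodMk hu1
  have f1 := DifferentiableAt.hasDerivAt_comp_of_eq (F := E →L[ℝ] E →L[ℝ] ℝ) hB hu1 hut
  have f2 : HasDerivAt (fun s : ℝ ↦ fderiv ℝ Φ (z₀, u s)) (D2 (0, a)) t := by
    have h1 : HasFDerivAt (fderiv ℝ Φ) D2 ((fun s : ℝ ↦ ((z₀, u s) : P × E)) t) := by
      simpa [hut] using hΦ'.hasFDerivAt
    exact h1.comp_hasDerivAt t hline'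
  have f3 : HasDerivAt (fun s : ℝ ↦ fderiv ℝ Φ (z₀, u s) (K, 0)) (D2 (0, a) (K, 0)) t := by
    simpa using f2.clm_apply (hasDerivAt_const t (K, (0 : E)))
  have f4 := (f1.clm_apply hu2).clm_apply f3
  have f5 := f4.unique ((hasDerivAt_const t μ).congr_of_eventuallyEq hcons)
  simp only [hut, ← ha, ← hk, add_apply] at f5
  -- Invariance of the energy says $\partial_kB(a,a)+2B(a,D^2\Phi(K,a))=0$. Conservation says
  -- $B(u'',k)+\partial_aB(a,k)+B(a,D^2\Phi(a,K))=0$. Symmetry of $D^2\Phi$ lets half of the former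
  -- cancel the Hessian term of the latter.
  rw [hsym2, hsymm (D2 (0, a) (K, 0)) a] at r1
  linarith

/-- The derivative in the second variable depends differentiably on the first one. -/
theorem hasFDerivAt_partial {f : P × E → F} {p₀ : P} {z₀ : E} (hf : ContDiffAt ℝ ∞ f (p₀, z₀)) :
    HasFDerivAt (fun p ↦ fderiv ℝ (fun z ↦ f (p, z)) z₀)
      (((ContinuousLinearMap.compL ℝ E (P × E) F).flip (ContinuousLinearMap.inr ℝ P E)) ∘L
        (fderiv ℝ (fderiv ℝ f) (p₀, z₀)) ∘L (ContinuousLinearMap.inl ℝ P E)) p₀ := by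
  have hf' : DifferentiableAt ℝ (fderiv ℝ f) (p₀, z₀) :=
    (hf.fderiv_right (m := 1) (by norm_cast)).differentiableAt (by simp)
  have h1 : HasFDerivAt (fun p ↦ fderiv ℝ f (p, z₀))
      ((fderiv ℝ (fderiv ℝ f) (p₀, z₀)) ∘L (ContinuousLinearMap.inl ℝ P E)) p₀ :=
    HasFDerivAt.comp p₀ (g := fderiv ℝ f) hf'.hasFDerivAt (hasFDerivAt_prodMk_left p₀ z₀)
  have h2 := (((ContinuousLinearMap.compL ℝ E (P × E) F).flip
    (ContinuousLinearMap.inr ℝ P E)).hasFDerivAt (x := fderiv ℝ f (p₀, z₀))).comp p₀ h1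
  refine h2.congr_of_eventuallyEq ?_
  have h3 : ∀ᶠ q in 𝓝 (p₀, z₀), DifferentiableAt ℝ f q :=
    ((hf.of_le (m := 1) (by norm_cast)).eventually (by simp)).mono
      fun q hq ↦ hq.differentiableAt (by simp)
  have h4 : Tendsto (fun p : P ↦ (p, z₀)) (𝓝 p₀) (𝓝 (p₀, z₀)) := by
    have : Continuous fun p : P ↦ (p, z₀) := by fun_prop
    exact this.tendsto p₀
  filter_upwards [h4.eventually h3] with p hp
  exact (hp.hasFDerivAt.comp z₀ (hasFDerivAt_prodMk_right p z₀)).fderiv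

/-- The derivative in the first variable depends differentiably on the second one. -/
theorem hasFDerivAt_partial_left {f : P × E → F} {p₀ : P} {z₀ : E}
    (hf : ContDiffAt ℝ ∞ f (p₀, z₀)) :
    HasFDerivAt (fun z ↦ fderiv ℝ (fun p ↦ f (p, z)) p₀)
      (((ContinuousLinearMap.compL ℝ P (P × E) F).flip (ContinuousLinearMap.inl ℝ P E)) ∘L
        (fderiv ℝ (fderiv ℝ f) (p₀, z₀)) ∘L (ContinuousLinearMap.inr ℝ P E)) z₀ := by
  have hf' : DifferentiableAt ℝ (fderiv ℝ f) (p₀, z₀) :=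
    (hf.fderiv_right (m := 1) (by norm_cast)).differentiableAt (by simp)
  have h1 : HasFDerivAt (fun z ↦ fderiv ℝ f (p₀, z))
      ((fderiv ℝ (fderiv ℝ f) (p₀, z₀)) ∘L (ContinuousLinearMap.inr ℝ P E)) z₀ :=
    HasFDerivAt.comp z₀ (g := fderiv ℝ f) hf'.hasFDerivAt (hasFDerivAt_prodMk_right p₀ z₀)
  have h2 := (((ContinuousLinearMap.compL ℝ P (P × E) F).flip
    (ContinuousLinearMap.inl ℝ P E)).hasFDerivAt (x := fderiv ℝ f (p₀, z₀))).comp z₀ h1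
  refine h2.congr_of_eventuallyEq ?_
  have h3 : ∀ᶠ q in 𝓝 (p₀, z₀), DifferentiableAt ℝ f q :=
    ((hf.of_le (m := 1) (by norm_cast)).eventually (by simp)).mono
      fun q hq ↦ hq.differentiableAt (by simp)
  have h4 : Tendsto (fun z : E ↦ (p₀, z)) (𝓝 z₀) (𝓝 (p₀, z₀)) := by
    have : Continuous fun z : E ↦ (p₀, z) := by fun_prop
    exact this.tendsto z₀
  filter_upwards [h4.eventually h3] with z hz
  exact (hz.hasFDerivAt.comp p₀ (hasFDerivAt_prodMk_left p₀ z)).fderiv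

end Calculus

/-! ### Derivatives of maps between manifolds, with tangent spaces identified with the model -/

section ManifoldCalculus

open Filter Topology

variable {E : Type*} [NormedAddCommGroup E] [NormedSpace ℝ E]
  {M : Type*} [TopologicalSpace M] [ChartedSpace E M]
  {E' : Type*} [NormedAddCommGroup E'] [NormedSpace ℝ E']
  {M' : Type*} [TopologicalSpace M'] [ChartedSpace E' M']
  {E'' : Type*} [NormedAddCommGroup E''] [NormedSpace ℝ E'']
  {M'' : Type*} [TopologicalSpace M''] [ChartedSpace E'' M'']

/-- The derivative of a map between manifolds modelled on normed spaces, as a linear map of the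
model spaces, with which all tangent spaces are identified. -/
def dmap (f : M → M') (x : M) : E →L[ℝ] E' := mfderiv 𝓘(ℝ, E) 𝓘(ℝ, E') f x

theorem dmap_comp {g : M' → M''} {f : M → M'} {x : M}
    (hg : MDifferentiableAt 𝓘(ℝ, E') 𝓘(ℝ, E'') g (f x))
    (hf : MDifferentiableAt 𝓘(ℝ, E) 𝓘(ℝ, E') f x) :
    (dmap (fun x ↦ g (f x)) x : E →L[ℝ] E'') = (dmap g (f x) : E' →L[ℝ] E'').comp (dmap f x) :=
  mfderiv_comp x hg hf

theorem dmap_comp_apply {g : M' → M''} {f : M → M'} {x : M}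
    (hg : MDifferentiableAt 𝓘(ℝ, E') 𝓘(ℝ, E'') g (f x))
    (hf : MDifferentiableAt 𝓘(ℝ, E) 𝓘(ℝ, E') f x) (v : E) :
    (dmap (fun x ↦ g (f x)) x : E →L[ℝ] E'') v
      = (dmap g (f x) : E' →L[ℝ] E'') ((dmap f x : E →L[ℝ] E') v) := by
  rw [dmap_comp hg hf]; rfl

theorem dmap_congr {f g : M → M'} {x : M} (h : f =ᶠ[𝓝 x] g) :
    (dmap f x : E →L[ℝ] E') = dmap g x :=
  h.mfderiv_eq

theorem dmap_id (x : M) : (dmap (fun x : M ↦ x) x : E →L[ℝ] E) = ContinuousLinearMap.id ℝ E :=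
  mfderiv_id

theorem dmap_const (x : M) (c : M') : (dmap (fun _ : M ↦ c) x : E →L[ℝ] E') = 0 :=
  mfderiv_const

theorem dmap_eq_fderiv (f : E → E') (x : E) : dmap f x = fderiv ℝ f x :=
  mfderiv_eq_fderiv

theorem eventually_ext_symm_left {x₀ x : M} (hx : x ∈ (extChartAt 𝓘(ℝ, E) x₀).source) :
    ∀ᶠ x' in 𝓝 x, (extChartAt 𝓘(ℝ, E) x₀).symm (extChartAt 𝓘(ℝ, E) x₀ x') = x' := by
  filter_upwards [(isOpen_extChartAt_source (I := 𝓘(ℝ, E)) x₀).mem_nhds hx] with x' hx'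
  exact (extChartAt 𝓘(ℝ, E) x₀).left_inv hx'

theorem eventually_ext_symm_right {x₀ : M} {y : E} (hy : y ∈ (extChartAt 𝓘(ℝ, E) x₀).target) :
    ∀ᶠ y' in 𝓝 y, extChartAt 𝓘(ℝ, E) x₀ ((extChartAt 𝓘(ℝ, E) x₀).symm y') = y' := by
  filter_upwards [(isOpen_extChartAt_target (I := 𝓘(ℝ, E)) x₀).mem_nhds hy] with y' hy'
  exact (extChartAt 𝓘(ℝ, E) x₀).right_inv hy'

section Charts

variable [IsManifold 𝓘(ℝ, E) ∞ M]

theorem contMDiffAt_extChartAt_of_mem {x₀ x : M} (hx : x ∈ (extChartAt 𝓘(ℝ, E) x₀).source) :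
    ContMDiffAt 𝓘(ℝ, E) 𝓘(ℝ, E) ∞ (extChartAt 𝓘(ℝ, E) x₀) x :=
  contMDiffAt_extChartAt' (by simpa using hx)

theorem contMDiffAt_extChartAt_symm_of_mem {x₀ : M} {y : E}
    (hy : y ∈ (extChartAt 𝓘(ℝ, E) x₀).target) :
    ContMDiffAt 𝓘(ℝ, E) 𝓘(ℝ, E) ∞ (extChartAt 𝓘(ℝ, E) x₀).symm y :=
  (contMDiffOn_extChartAt_symm x₀).contMDiffAt ((isOpen_extChartAt_target x₀).mem_nhds hy)

theorem mdifferentiableAt_ext {x₀ x : M} (hx : x ∈ (extChartAt 𝓘(ℝ, E) x₀).source) :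
    MDifferentiableAt 𝓘(ℝ, E) 𝓘(ℝ, E) (extChartAt 𝓘(ℝ, E) x₀) x :=
  (contMDiffAt_extChartAt_of_mem hx).mdifferentiableAt (by simp)

theorem mdifferentiableAt_ext_symm {x₀ : M} {y : E}
    (hy : y ∈ (extChartAt 𝓘(ℝ, E) x₀).target) :
    MDifferentiableAt 𝓘(ℝ, E) 𝓘(ℝ, E) (extChartAt 𝓘(ℝ, E) x₀).symm y :=
  (contMDiffAt_extChartAt_symm_of_mem hy).mdifferentiableAt (by simp)

theorem dmap_ext_dmap_symm {x₀ : M} {y : E} (hy : y ∈ (extChartAt 𝓘(ℝ, E) x₀).target) (v : E) :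
    (dmap (extChartAt 𝓘(ℝ, E) x₀) ((extChartAt 𝓘(ℝ, E) x₀).symm y) : E →L[ℝ] E)
      ((dmap (extChartAt 𝓘(ℝ, E) x₀).symm y : E →L[ℝ] E) v) = v := by
  rw [← dmap_comp_apply (mdifferentiableAt_ext ((extChartAt 𝓘(ℝ, E) x₀).map_target hy))
    (mdifferentiableAt_ext_symm hy), dmap_congr (eventually_ext_symm_right hy), dmap_id]
  rfl

theorem dmap_symm_dmap_ext {x₀ x : M} (hx : x ∈ (extChartAt 𝓘(ℝ, E) x₀).source) (v : E) :
    (dmap (extChartAt 𝓘(ℝ, E) x₀).symm (extChartAt 𝓘(ℝ, E) x₀ x) : E →L[ℝ] E)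
      ((dmap (extChartAt 𝓘(ℝ, E) x₀) x : E →L[ℝ] E) v) = v := by
  rw [← dmap_comp_apply (mdifferentiableAt_ext_symm ((extChartAt 𝓘(ℝ, E) x₀).map_source hx))
    (mdifferentiableAt_ext hx), dmap_congr (eventually_ext_symm_left hx), dmap_id]
  rfl

theorem dmap_ext_self (x₀ : M) :
    (dmap (extChartAt 𝓘(ℝ, E) x₀) x₀ : E →L[ℝ] E) = ContinuousLinearMap.id ℝ E :=
  mfderiv_extChartAt_self

theorem dmap_symm_self (x₀ : M) : (dmap (extChartAt 𝓘(ℝ, E) x₀).symm (extChartAt 𝓘(ℝ, E) x₀ x₀) :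
    E →L[ℝ] E) = ContinuousLinearMap.id ℝ E := by
  ext v
  have := dmap_symm_dmap_ext (mem_extChartAt_source (I := 𝓘(ℝ, E)) x₀) v
  rwa [dmap_ext_self] at this

end Charts

end ManifoldCalculus

/-! ### The metric in charts -/

section Metric

open Filter Topology

variable {E : Type*} [NormedAddCommGroup E] [NormedSpace ℝ E]
  {M : Type*} [TopologicalSpace M] [ChartedSpace E M] [IsManifold 𝓘(ℝ, E) ∞ M]

namespace PseudoRiemannianMetric

/-- The scalar product as a bilinear form on the model space. -/
def form (g : PseudoRiemannianMetric E M) (x : M) : E →L[ℝ] E →L[ℝ] ℝ := g.inner x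

theorem form_symm (g : PseudoRiemannianMetric E M) (x : M) (v w : E) :
    g.form x v w = g.form x w v := g.symm x v w

theorem eq_zero_of_form (g : PseudoRiemannianMetric E M) (x : M) (v : E)
    (h : ∀ w, g.form x v w = 0) : v = 0 := g.nondegenerate x v h

theorem coord_apply (g : PseudoRiemannianMetric E M) (x₀ : M) (y v w : E) :
    g.coord x₀ y v w = g.form ((extChartAt 𝓘(ℝ, E) x₀).symm y)
      ((dmap (extChartAt 𝓘(ℝ, E) x₀).symm y : E →L[ℝ] E) v)
      ((dmap (extChartAt 𝓘(ℝ, E) x₀).symm y : E →L[ℝ] E) w) := rfl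

theorem coord_symm (g : PseudoRiemannianMetric E M) (x₀ : M) (y v w : E) :
    g.coord x₀ y v w = g.coord x₀ y w v := by
  rw [coord_apply, coord_apply, form_symm]

/-- Constant vectors pushed forward by the inverse chart form smooth vector fields along it, and the
metric, a smooth section of the bundle of forms, is evaluated on two of them. -/
theorem contDiffOn_coord_apply (g : PseudoRiemannianMetric E M) (x₀ : M) (v w : E) :
    ContDiffOn ℝ ∞ (fun y ↦ g.coord x₀ y v w) (extChartAt 𝓘(ℝ, E) x₀).target := by
  have hT : ∀ v : E, ContMDiffOn 𝓘(ℝ, E) (𝓘(ℝ, E).prod 𝓘(ℝ, E)) ∞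
      (fun y ↦ (Bundle.TotalSpace.mk' E ((extChartAt 𝓘(ℝ, E) x₀).symm y)
        (mfderiv 𝓘(ℝ, E) 𝓘(ℝ, E) (extChartAt 𝓘(ℝ, E) x₀).symm y v) : TangentBundle 𝓘(ℝ, E) M))
      (extChartAt 𝓘(ℝ, E) x₀).target := by
    intro v
    have h1 := (contMDiffOn_extChartAt_symm (I := 𝓘(ℝ, E)) (n := ∞) x₀)
    have h2 := h1.contMDiffOn_tangentMapWithin (m := ∞) (by simp)
      (isOpen_extChartAt_target (I := 𝓘(ℝ, E)) x₀).uniqueMDiffOn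
    have h3 : ContMDiff 𝓘(ℝ, E) (𝓘(ℝ, E).prod 𝓘(ℝ, E)) ∞
        (fun y : E ↦ (⟨y, v⟩ : TangentBundle 𝓘(ℝ, E) E)) := by
      exact contMDiff_vectorSpace_iff_contDiff.mpr contDiff_const
    have h4 := h2.comp h3.contMDiffOn (s := (extChartAt 𝓘(ℝ, E) x₀).target) (fun y hy ↦ hy)
    refine h4.congr fun y hy ↦ ?_
    simp only [Function.comp, tangentMapWithin]
    rw [mfderivWithin_of_isOpen (isOpen_extChartAt_target (I := 𝓘(ℝ, E)) x₀) hy]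
  intro y hy
  rw [← contMDiffWithinAt_iff_contDiffWithinAt]
  have h1 : ContMDiffWithinAt 𝓘(ℝ, E) (𝓘(ℝ, E).prod 𝓘(ℝ)) ∞
      (fun m ↦ Bundle.TotalSpace.mk' ℝ (E := Bundle.Trivial M ℝ) ((extChartAt 𝓘(ℝ, E) x₀).symm m)
        (g.inner ((extChartAt 𝓘(ℝ, E) x₀).symm m)
          (mfderiv 𝓘(ℝ, E) 𝓘(ℝ, E) (extChartAt 𝓘(ℝ, E) x₀).symm m v)
          (mfderiv 𝓘(ℝ, E) 𝓘(ℝ, E) (extChartAt 𝓘(ℝ, E) x₀).symm m w)))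
      (extChartAt 𝓘(ℝ, E) x₀).target y := by
    apply ContMDiffWithinAt.clm_bundle_apply₂ (F₁ := E) (F₂ := E)
    · exact ContMDiffAt.comp_contMDiffWithinAt y g.contMDiff.contMDiffAt
        (contMDiffOn_extChartAt_symm x₀ y hy)
    · exact hT v y hy
    · exact hT w y hy
  simp only [Bundle.contMDiffWithinAt_totalSpace] at h1
  exact h1.2

theorem contDiffAt_coord [FiniteDimensional ℝ E] (g : PseudoRiemannianMetric E M) (x₀ : M) {y : E}
    (hy : y ∈ (extChartAt 𝓘(ℝ, E) x₀).target) : ContDiffAt ℝ ∞ (g.coord x₀) y := by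
  have : ContDiffOn ℝ ∞ (g.coord x₀) (extChartAt 𝓘(ℝ, E) x₀).target :=
    contDiffOn_clm_apply.mpr fun v ↦ contDiffOn_clm_apply.mpr fun w ↦
      g.contDiffOn_coord_apply x₀ v w
  exact this.contDiffAt ((isOpen_extChartAt_target x₀).mem_nhds hy)

end PseudoRiemannianMetric

end Metric

/-! ### Adjoint representation and bracket in a chart at the identity -/

section LieGroupCalculus

open Filter Topology

variable {E : Type*} [NormedAddCommGroup E] [NormedSpace ℝ E]
  {N : Type*} [TopologicalSpace N] [ChartedSpace E N] [Group N] [LieGroup 𝓘(ℝ, E) ∞ N]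

variable (E N) in
/-- The parametrization of a neighbourhood of `1` by the inverse of the chart. -/
def param (z : E) : N := (extChartAt 𝓘(ℝ, E) (1 : N)).symm z

variable (E N) in
/-- The chart around `1`. -/
def chartOne (x : N) : E := extChartAt 𝓘(ℝ, E) (1 : N) x

variable (E N) in
/-- The coordinates of `1`. -/
def originPt : E := chartOne E N 1

@[simp] theorem param_originPt : param E N (originPt E N) = 1 := extChartAt_to_inv _

@[simp] theorem chartOne_one : chartOne E N 1 = originPt E N := rfl

theorem one_mem_source : (1 : N) ∈ (extChartAt 𝓘(ℝ, E) (1 : N)).source := mem_extChartAt_source _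

theorem originPt_mem_target : originPt E N ∈ (extChartAt 𝓘(ℝ, E) (1 : N)).target :=
  mem_extChartAt_target _

theorem contMDiffAt_param : ContMDiffAt 𝓘(ℝ, E) 𝓘(ℝ, E) ∞ (param E N) (originPt E N) :=
  contMDiffAt_extChartAt_symm_of_mem originPt_mem_target

theorem contMDiffAt_chartOne : ContMDiffAt 𝓘(ℝ, E) 𝓘(ℝ, E) ∞ (chartOne E N) 1 :=
  contMDiffAt_extChartAt_of_mem one_mem_source

theorem mdifferentiableAt_param :
    MDifferentiableAt 𝓘(ℝ, E) 𝓘(ℝ, E) (param E N) (originPt E N) :=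
  contMDiffAt_param.mdifferentiableAt (by simp)

theorem mdifferentiableAt_chartOne : MDifferentiableAt 𝓘(ℝ, E) 𝓘(ℝ, E) (chartOne E N) 1 :=
  contMDiffAt_chartOne.mdifferentiableAt (by simp)

theorem dmap_param : (dmap (param E N) (originPt E N) : E →L[ℝ] E) = ContinuousLinearMap.id ℝ E :=
  dmap_symm_self 1

theorem dmap_chartOne : (dmap (chartOne E N) (1 : N) : E →L[ℝ] E) = ContinuousLinearMap.id ℝ E :=
  dmap_ext_self 1

variable (E) in
theorem mdifferentiable_leftMul (a : N) :
    MDifferentiable 𝓘(ℝ, E) 𝓘(ℝ, E) (fun x : N ↦ a * x) :=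
  (contMDiff_mul_left (I := 𝓘(ℝ, E)) (n := ∞)).mdifferentiable (by simp)

variable (E) in
theorem mdifferentiable_rightMul (a : N) :
    MDifferentiable 𝓘(ℝ, E) 𝓘(ℝ, E) (fun x : N ↦ x * a) :=
  (contMDiff_mul_right (I := 𝓘(ℝ, E)) (n := ∞)).mdifferentiable (by simp)

variable (E) in
theorem mdifferentiable_conj (a : N) :
    MDifferentiable 𝓘(ℝ, E) 𝓘(ℝ, E) (fun x : N ↦ a * x * a⁻¹) :=
  (mdifferentiable_rightMul E a⁻¹).comp (mdifferentiable_leftMul E a)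

/-- The derivative at `1` of a map which fixes `1`, in the chart. -/
theorem dmap_one_eq {f : N → N} (hf : MDifferentiableAt 𝓘(ℝ, E) 𝓘(ℝ, E) f 1) (h1 : f 1 = 1) :
    (dmap f 1 : E →L[ℝ] E) = fderiv ℝ (fun z ↦ chartOne E N (f (param E N z))) (originPt E N) := by
  have hf' : MDifferentiableAt 𝓘(ℝ, E) 𝓘(ℝ, E) f (param E N (originPt E N)) := by simpa using hf
  have hfp : MDifferentiableAt 𝓘(ℝ, E) 𝓘(ℝ, E) (fun z ↦ f (param E N z)) (originPt E N) :=
    hf'.comp _ mdifferentiableAt_param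
  have h2 : f (param E N (originPt E N)) = 1 := by simp [h1]
  rw [← dmap_eq_fderiv, dmap_comp (g := chartOne E N) (by rw [h2]; exact mdifferentiableAt_chartOne)
    hfp, dmap_comp hf' mdifferentiableAt_param, h2, dmap_chartOne, dmap_param, param_originPt]
  rfl

variable (E) in
/-- The adjoint representation. -/
def Ad (a : N) : E →L[ℝ] E := dmap (fun x : N ↦ a * x * a⁻¹) 1

theorem dmap_comp_one {f g : N → N} (hg : MDifferentiableAt 𝓘(ℝ, E) 𝓘(ℝ, E) g 1)
    (hf : MDifferentiableAt 𝓘(ℝ, E) 𝓘(ℝ, E) f 1) (hf1 : f 1 = 1) :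
    (dmap (fun x ↦ g (f x)) 1 : E →L[ℝ] E) = (dmap g 1 : E →L[ℝ] E).comp (dmap f 1) := by
  rw [dmap_comp (by rwa [hf1]) hf, hf1]

theorem Ad_one : Ad E (1 : N) = ContinuousLinearMap.id ℝ E := by
  have : (fun x : N ↦ 1 * x * 1⁻¹) = fun x ↦ x := by ext; simp
  rw [Ad, this, dmap_id]

theorem Ad_mul (a b : N) : Ad E (a * b) = (Ad E a).comp (Ad E b) := by
  have : (fun x : N ↦ (a * b) * x * (a * b)⁻¹)
      = fun x ↦ (fun x ↦ a * x * a⁻¹) ((fun x ↦ b * x * b⁻¹) x) := by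
    ext; simp [mul_assoc]
  rw [Ad, this, dmap_comp_one (g := fun x ↦ a * x * a⁻¹) (f := fun x ↦ b * x * b⁻¹)
    (mdifferentiable_conj E a 1) (mdifferentiable_conj E b 1) (by simp)]
  rfl

/-- The derivative of a smooth automorphism intertwines the adjoint representation. -/
theorem dmap_comp_Ad {f : N →* N} (hf : MDifferentiableAt 𝓘(ℝ, E) 𝓘(ℝ, E) f 1) (a : N) :
    (dmap f 1 : E →L[ℝ] E).comp (Ad E a) = (Ad E (f a)).comp (dmap f 1) := by
  rw [Ad, Ad, ← dmap_comp_one hf (mdifferentiable_conj E a 1) (by simp),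
    ← dmap_comp_one (mdifferentiable_conj E (f a) 1) hf (map_one f)]
  congr 1
  ext x
  simp

variable (E N) in
/-- The group multiplication in the chart around `1`. -/
def mulChart (p : E × E) : E := chartOne E N (param E N p.1 * param E N p.2)

theorem contDiffAt_mul_chart (x₁ : N) {y : E} (hy : y ∈ (extChartAt 𝓘(ℝ, E) x₁).target) :
    ContDiffAt ℝ ∞ (fun p : E × E ↦ extChartAt 𝓘(ℝ, E) x₁
      (param E N p.1 * (extChartAt 𝓘(ℝ, E) x₁).symm p.2)) (originPt E N, y) := by
  rw [← contMDiffAt_iff_contDiffAt]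
  have h1 : ContMDiffAt 𝓘(ℝ, E × E) 𝓘(ℝ, E) ∞ (fun p : E × E ↦ param E N p.1)
      (originPt E N, y) :=
    contMDiffAt_param.comp (originPt E N, y) contDiff_fst.contMDiff.contMDiffAt
  have h2 : ContMDiffAt 𝓘(ℝ, E × E) 𝓘(ℝ, E) ∞
      (fun p : E × E ↦ (extChartAt 𝓘(ℝ, E) x₁).symm p.2) (originPt E N, y) :=
    (contMDiffAt_extChartAt_symm_of_mem hy).comp (originPt E N, y)
      contDiff_snd.contMDiff.contMDiffAt
  refine ContMDiffAt.comp (originPt E N, y) (g := extChartAt 𝓘(ℝ, E) x₁) ?_ (h1.mul h2)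
  refine contMDiffAt_extChartAt_of_mem ?_
  simpa using (extChartAt 𝓘(ℝ, E) x₁).map_target hy

theorem contDiffAt_mulChart : ContDiffAt ℝ ∞ (mulChart E N) (originPt E N, originPt E N) :=
  contDiffAt_mul_chart 1 originPt_mem_target

theorem contDiffAt_conj_chart :
    ContDiffAt ℝ ∞ (fun p : E × E ↦ chartOne E N (param E N p.1 * param E N p.2 *
      (param E N p.1)⁻¹)) (originPt E N, originPt E N) := by
  rw [← contMDiffAt_iff_contDiffAt]
  have h1 : ContMDiffAt 𝓘(ℝ, E × E) 𝓘(ℝ, E) ∞ (fun p : E × E ↦ param E N p.1)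
      (originPt E N, originPt E N) :=
    contMDiffAt_param.comp (originPt E N, originPt E N) contDiff_fst.contMDiff.contMDiffAt
  have h2 : ContMDiffAt 𝓘(ℝ, E × E) 𝓘(ℝ, E) ∞ (fun p : E × E ↦ param E N p.2)
      (originPt E N, originPt E N) :=
    contMDiffAt_param.comp (originPt E N, originPt E N) contDiff_snd.contMDiff.contMDiffAt
  refine ContMDiffAt.comp (originPt E N, originPt E N) (g := chartOne E N) ?_
    ((h1.mul h2).mul h1.inv)
  simpa using contMDiffAt_chartOne

variable (E N) in
/-- The mixed second derivative of the multiplication at `(1, 1)` in the chart. -/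
def mulHess : E →L[ℝ] E →L[ℝ] E :=
  ((ContinuousLinearMap.compL ℝ E (E × E) E).flip (ContinuousLinearMap.inr ℝ E E)) ∘L
    (fderiv ℝ (fderiv ℝ (mulChart E N)) (originPt E N, originPt E N)) ∘L
      (ContinuousLinearMap.inl ℝ E E)

variable (E N) in
/-- The Lie bracket of `T₁N` as a bilinear map on the model space. -/
def ad : E →L[ℝ] E →L[ℝ] E := mulHess E N - (mulHess E N).flip

theorem ad_apply (X Y : E) : ad E N X Y = mulHess E N X Y - mulHess E N Y X := rfl

theorem ad_swap (X Y : E) : ad E N X Y = - ad E N Y X := by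
  rw [ad_apply, ad_apply, neg_sub]

theorem hasFDerivAt_mulChart_right :
    HasFDerivAt (fun y ↦ fderiv ℝ (fun z ↦ mulChart E N (y, z)) (originPt E N)) (mulHess E N)
      (originPt E N) :=
  hasFDerivAt_partial contDiffAt_mulChart

/-- The flip comes from the symmetry of the second derivative of the multiplication. -/
theorem hasFDerivAt_mulChart_left :
    HasFDerivAt (fun y ↦ fderiv ℝ (fun z ↦ mulChart E N (z, y)) (originPt E N))
      (mulHess E N).flip (originPt E N) := by
  have h := hasFDerivAt_partial_left (contDiffAt_mulChart (E := E) (N := N))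
  refine h.congr_fderiv ?_
  ext X Z
  exact (contDiffAt_mulChart (E := E) (N := N)).isSymmSndFDerivAt
    (by simp only [minSmoothness_of_isRCLikeNormedField]; exact WithTop.coe_le_coe.mpr le_top) _ _

theorem eventually_param_chartOne : ∀ᶠ x in 𝓝 (1 : N), param E N (chartOne E N x) = x :=
  eventually_ext_symm_left one_mem_source

theorem eventually_mem_source :
    ∀ᶠ y in 𝓝 (originPt E N), param E N y ∈ (extChartAt 𝓘(ℝ, E) (1 : N)).source := by
  filter_upwards [(isOpen_extChartAt_target (I := 𝓘(ℝ, E)) (1 : N)).mem_nhds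
    originPt_mem_target] with y hy
  exact (extChartAt 𝓘(ℝ, E) (1 : N)).map_target hy

theorem mdifferentiableAt_chartOne_of_mem {x : N}
    (hx : x ∈ (extChartAt 𝓘(ℝ, E) (1 : N)).source) :
    MDifferentiableAt 𝓘(ℝ, E) 𝓘(ℝ, E) (chartOne E N) x :=
  mdifferentiableAt_ext hx

variable (E) in
/-- The derivative at `1` of the multiplication by `x` on the right, which gives the values at `x`
of the right-invariant vector fields. -/
def dRight (x : N) : E →L[ℝ] E := dmap (fun a : N ↦ a * x) 1

variable (E) in
/-- The derivative at `1` of the multiplication by `x` on the left. -/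
def dLeft (x : N) : E →L[ℝ] E := dmap (fun a : N ↦ x * a) 1

/-- Conjugation by $x$ followed by right multiplication by $x$ is left multiplication by $x$. This
passes from right-invariant to left-invariant fields. -/
theorem dRight_comp_Ad (x : N) : (dRight E x).comp (Ad E x) = dLeft E x := by
  rw [dRight, Ad, ← dmap_comp_one (mdifferentiable_rightMul E x 1) (mdifferentiable_conj E x 1)
    (by simp)]
  simp [dLeft]

theorem fderiv_mulChart_left {y : E}
    (hy : param E N y ∈ (extChartAt 𝓘(ℝ, E) (1 : N)).source) :
    fderiv ℝ (fun z ↦ mulChart E N (z, y)) (originPt E N)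
      = (dmap (chartOne E N) (param E N y) : E →L[ℝ] E).comp (dRight E (param E N y)) := by
  have h1 : MDifferentiableAt 𝓘(ℝ, E) 𝓘(ℝ, E) (fun a : N ↦ a * param E N y)
    (param E N (originPt E N)) := mdifferentiable_rightMul E _ _
  have h2 := dmap_comp h1 mdifferentiableAt_param
  rw [dmap_param, ContinuousLinearMap.comp_id, param_originPt] at h2
  rw [← dmap_eq_fderiv]
  have h3 := dmap_comp (g := chartOne E N) (f := fun z ↦ param E N z * param E N y)
    (x := originPt E N) (by simpa using mdifferentiableAt_chartOne_of_mem hy)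
    (h1.comp (originPt E N) mdifferentiableAt_param)
  rw [h2, param_originPt, one_mul] at h3
  exact h3

theorem fderiv_mulChart_right {y : E}
    (hy : param E N y ∈ (extChartAt 𝓘(ℝ, E) (1 : N)).source) :
    fderiv ℝ (fun z ↦ mulChart E N (y, z)) (originPt E N)
      = (dmap (chartOne E N) (param E N y) : E →L[ℝ] E).comp (dLeft E (param E N y)) := by
  have h1 : MDifferentiableAt 𝓘(ℝ, E) 𝓘(ℝ, E) (fun a : N ↦ param E N y * a)
    (param E N (originPt E N)) := mdifferentiable_leftMul E _ _
  have h2 := dmap_comp h1 mdifferentiableAt_param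
  rw [dmap_param, ContinuousLinearMap.comp_id, param_originPt] at h2
  rw [← dmap_eq_fderiv]
  have h3 := dmap_comp (g := chartOne E N) (f := fun z ↦ param E N y * param E N z)
    (x := originPt E N) (by simpa using mdifferentiableAt_chartOne_of_mem hy)
    (h1.comp (originPt E N) mdifferentiableAt_param)
  rw [h2, param_originPt, mul_one] at h3
  exact h3

theorem dRight_one : dRight E (1 : N) = ContinuousLinearMap.id ℝ E := by
  simp only [dRight, mul_one]; exact dmap_id _

/-- The differential of the adjoint representation is the Lie bracket. -/
theorem hasFDerivAt_Ad : HasFDerivAt (fun y ↦ Ad E (param E N y)) (ad E N) (originPt E N) := by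
  have hA : DifferentiableAt ℝ (fun y ↦ Ad E (param E N y)) (originPt E N) := by
    have h := (hasFDerivAt_partial (contDiffAt_conj_chart (E := E) (N := N))).differentiableAt
    refine h.congr_of_eventuallyEq (Eventually.of_forall fun y ↦ ?_)
    exact dmap_one_eq (mdifferentiable_conj E _ 1) (by simp)
  -- Once differentiability is known, the value follows by differentiating right translation
  -- composed with $\mathrm{Ad}$ equals left translation: the flipped Hessian plus $A'$ is the
  -- Hessian.
  obtain ⟨A', hA'⟩ := hA
  have h1 := (hasFDerivAt_mulChart_left (E := E) (N := N)).clm_comp hA'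
  have h2 := (hasFDerivAt_mulChart_right (E := E) (N := N)).congr_of_eventuallyEq
    (f₁ := fun y ↦ (fderiv ℝ (fun z ↦ mulChart E N (z, y)) (originPt E N)).comp
      (Ad E (param E N y))) (by
      filter_upwards [eventually_mem_source] with y hy
      rw [fderiv_mulChart_left hy, fderiv_mulChart_right hy, ContinuousLinearMap.comp_assoc,
        dRight_comp_Ad])
  have h3 := h1.unique h2
  have h4 : fderiv ℝ (fun z ↦ mulChart E N (z, originPt E N)) (originPt E N)
      = ContinuousLinearMap.id ℝ E := by
    rw [fderiv_mulChart_left (by simp), param_originPt, dmap_chartOne,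
      dRight_one]
    rfl
  have h5 : A' = ad E N := by
    ext X Z
    have := DFunLike.congr_fun (DFunLike.congr_fun h3 X) Z
    simp only [h4, param_originPt, Ad_one] at this
    rw [ad_apply, ← this]
    simp
  rwa [← h5]

/-- A smooth homomorphism induces a homomorphism of Lie algebras. -/
theorem dmap_ad {f : N →* N} (hf : MDifferentiableAt 𝓘(ℝ, E) 𝓘(ℝ, E) f 1) (X Y : E) :
    (dmap f 1 : E →L[ℝ] E) (ad E N X Y)
      = ad E N ((dmap f 1 : E →L[ℝ] E) X) ((dmap f 1 : E →L[ℝ] E) Y) := by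
  set D : E →L[ℝ] E := dmap f 1 with hD
  have hf' : MDifferentiableAt 𝓘(ℝ, E) 𝓘(ℝ, E) f (param E N (originPt E N)) := by simpa using hf
  have hfp : MDifferentiableAt 𝓘(ℝ, E) 𝓘(ℝ, E) (fun z ↦ f (param E N z)) (originPt E N) :=
    hf'.comp _ mdifferentiableAt_param
  have h1 : HasFDerivAt (fun y ↦ D.comp ((Ad E (param E N y)))) _ (originPt E N) :=
    (hasFDerivAt_const D _).clm_comp (hasFDerivAt_Ad (E := E) (N := N))
  have h0 : chartOne E N (f (param E N (originPt E N))) = originPt E N := by simp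
  have h2 : HasFDerivAt (fun z ↦ chartOne E N (f (param E N z))) D (originPt E N) := by
    rw [hD, dmap_one_eq hf (map_one f)]
    refine DifferentiableAt.hasFDerivAt ?_
    rw [← mdifferentiableAt_iff_differentiableAt]
    exact MDifferentiableAt.comp (g := chartOne E N) _
      (by simpa using mdifferentiableAt_chartOne) hfp
  have h3 : HasFDerivAt (fun y ↦ Ad E (param E N (chartOne E N (f (param E N y)))))
      ((ad E N).comp D) (originPt E N) :=
    HasFDerivAt.comp (g := fun y ↦ Ad E (param E N y)) _ (by rw [h0]; exact hasFDerivAt_Ad) h2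
  -- Both sides of $D\circ\mathrm{Ad}(a)=\mathrm{Ad}(f(a))\circ D$ are differentiated at $a=1$.
  have h4 := (h3.clm_comp (hasFDerivAt_const D _)).congr_of_eventuallyEq
    (f₁ := fun y ↦ D.comp (Ad E (param E N y))) (by
      have hc : Tendsto (fun z ↦ f (param E N z)) (𝓝 (originPt E N)) (𝓝 1) := by
        have := hfp.continuousAt
        simpa [ContinuousAt] using this
      filter_upwards [hc.eventually (eventually_param_chartOne (E := E))] with y hy
      rw [hy, dmap_comp_Ad hf])
  have h5 := DFunLike.congr_fun (DFunLike.congr_fun (h1.unique h4) X) Y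
  simpa using h5

theorem Ad_ad (a : N) (X Y : E) : Ad E a (ad E N X Y) = ad E N (Ad E a X) (Ad E a Y) :=
  dmap_ad (f := (MulAut.conj a).toMonoidHom) (mdifferentiable_conj E a 1) X Y

/-- Derivative at the identity, in the direction $X$, of the fact that $\mathrm{Ad}$ acts by
automorphisms of the bracket. -/
theorem ad_jacobi (X Y Z : E) :
    ad E N X (ad E N Y Z) = ad E N (ad E N X Y) Z + ad E N Y (ad E N X Z) := by
  have h := hasFDerivAt_Ad (E := E) (N := N)
  have hY := h.clm_apply (hasFDerivAt_const Y (originPt E N))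
  have hZ := h.clm_apply (hasFDerivAt_const Z (originPt E N))
  have h1 := h.clm_apply (hasFDerivAt_const (ad E N Y Z) (originPt E N))
  have h2 := (((ad E N).hasFDerivAt.comp (originPt E N) hY).clm_apply hZ)
  have h3 := h1.unique (h2.congr_of_eventuallyEq (Eventually.of_forall fun y ↦ Ad_ad _ _ _))
  have := DFunLike.congr_fun h3 X
  simp only [param_originPt, Ad_one] at this
  simpa [add_comm, Ad_one] using this

end LieGroupCalculus

/-! ### Comparison of the brackets; nilpotency of the Lie algebra -/

section LieGroupAlgebra

open Filter Topology

variable {E : Type*} [NormedAddCommGroup E] [NormedSpace ℝ E]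
  {N : Type*} [TopologicalSpace N] [ChartedSpace E N] [Group N] [LieGroup 𝓘(ℝ, E) ∞ N]

/-- A left-invariant vector field in the chart around `1`. -/
theorem mpullback_mulInvariantVectorField_chart (X : E) :
    (fun y ↦ (VectorField.mpullbackWithin 𝓘(ℝ, E) 𝓘(ℝ, E) (extChartAt 𝓘(ℝ, E) (1 : N)).symm
      (mulInvariantVectorField (I := 𝓘(ℝ, E)) (X : GroupLieAlgebra 𝓘(ℝ, E) N))
      (Set.range 𝓘(ℝ, E)) y : E)) =ᶠ[𝓝 (originPt E N)]
      fun y ↦ fderiv ℝ (fun z ↦ mulChart E N (y, z)) (originPt E N) X := by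
  filter_upwards [(isOpen_extChartAt_target (I := 𝓘(ℝ, E)) (1 : N)).mem_nhds
    originPt_mem_target] with y hy
  have hys := (extChartAt 𝓘(ℝ, E) (1 : N)).map_target hy
  rw [fderiv_mulChart_right hys]
  simp only [VectorField.mpullbackWithin, modelWithCornersSelf_coe, Set.range_id,
    mfderivWithin_univ]
  have h1 : ContinuousLinearMap.inverse
      (dmap (extChartAt 𝓘(ℝ, E) (1 : N)).symm y : E →L[ℝ] E)
      = dmap (chartOne E N) (param E N y) := by
    refine ContinuousLinearMap.inverse_eq ?_ ?_
    · ext v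
      have := dmap_symm_dmap_ext hys v
      rwa [(extChartAt 𝓘(ℝ, E) (1 : N)).right_inv hy] at this
    · ext v
      exact dmap_ext_dmap_symm hy v
  exact DFunLike.congr_fun h1 _

theorem lieBracketWithin_eq_of_hasFDerivAt {V W : E → E} {V' W' : E →L[ℝ] E} {s : Set E} {z : E}
    (hs : s = Set.univ) (hV : HasFDerivAt V V' z) (hW : HasFDerivAt W W' z) :
    VectorField.lieBracketWithin ℝ V W s z = W' (V z) - V' (W z) := by
  simp only [VectorField.lieBracketWithin, hs, fderivWithin_univ, hV.fderiv, hW.fderiv]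

/-- The bracket of the Lie algebra of `N` in terms of the group multiplication in the chart. -/
theorem bracket_eq_ad (X Y : GroupLieAlgebra 𝓘(ℝ, E) N) :
    (⁅X, Y⁆ : GroupLieAlgebra 𝓘(ℝ, E) N) = ad E N X Y := by
  rw [GroupLieAlgebra.bracket_def, ← VectorField.mlieBracketWithin_univ,
    VectorField.mlieBracketWithin_apply]
  -- In the chart a left-invariant field is the derivative of the multiplication in its second
  -- argument, so its own derivative at the origin is the Hessian with the field vector in the
  -- second slot.
  have h0 : ∀ X : E, HasFDerivAt (fun y ↦ (VectorField.mpullbackWithin 𝓘(ℝ, E) 𝓘(ℝ, E)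
      (extChartAt 𝓘(ℝ, E) (1 : N)).symm
      (mulInvariantVectorField (I := 𝓘(ℝ, E)) (X : GroupLieAlgebra 𝓘(ℝ, E) N))
      (Set.range 𝓘(ℝ, E)) y : E)) ((mulHess E N).flip X) (originPt E N) := by
    intro X
    have h := (hasFDerivAt_mulChart_right (E := E) (N := N)).clm_apply
      (hasFDerivAt_const X (originPt E N))
    refine (h.congr_of_eventuallyEq (mpullback_mulInvariantVectorField_chart X)).congr_fderiv ?_
    ext Z; simp
  have h1 : ∀ X : E, (VectorField.mpullbackWithin 𝓘(ℝ, E) 𝓘(ℝ, E)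
      (extChartAt 𝓘(ℝ, E) (1 : N)).symm
      (mulInvariantVectorField (I := 𝓘(ℝ, E)) (X : GroupLieAlgebra 𝓘(ℝ, E) N))
      (Set.range 𝓘(ℝ, E)) (originPt E N) : E) = X := by
    intro X
    refine (mpullback_mulInvariantVectorField_chart X).self_of_nhds.trans ?_
    beta_reduce
    rw [fderiv_mulChart_right (by simp)]
    simp [dmap_chartOne, dLeft, dmap_id]
  have h2 : ContinuousLinearMap.inverse (dmap (extChartAt 𝓘(ℝ, E) (1 : N)) (1 : N) : E →L[ℝ] E)
      = ContinuousLinearMap.id ℝ E := by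
    rw [dmap_ext_self]; exact ContinuousLinearMap.inverse_id
  refine (DFunLike.congr_fun h2 _).trans ?_
  refine (lieBracketWithin_eq_of_hasFDerivAt (by simp) (h0 X) (h0 Y)).trans ?_
  rw [h1 X, h1 Y]
  rfl

/-- Iterated commutators with a list of group elements. -/
def iterComm (l : List N) (b : N) : N := l.foldr (fun a x ↦ a * x * a⁻¹ * x⁻¹) b

theorem iterComm_one (l : List N) : iterComm l 1 = 1 := by
  induction l with
  | nil => rfl
  | cons a l ih =>
    change a * iterComm l 1 * a⁻¹ * (iterComm l 1)⁻¹ = 1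
    simp [ih]

theorem iterComm_mem (l : List N) (b : N) :
    iterComm l b ∈ (⊤ : Subgroup N).lowerCentralSeries l.length := by
  induction l with
  | nil => simp
  | cons a l ih =>
    change a * iterComm l b * a⁻¹ * (iterComm l b)⁻¹ ∈ _
    rw [List.length_cons, Subgroup.lowerCentralSeries_succ, Subgroup.commutator_comm]
    exact Subgroup.commutator_mem_commutator (Subgroup.mem_top a) ih

theorem hasFDerivAt_mulChart : HasFDerivAt (mulChart E N)
    (ContinuousLinearMap.fst ℝ E E + ContinuousLinearMap.snd ℝ E E)
    (originPt E N, originPt E N) := by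
  have h := ((contDiffAt_mulChart (E := E) (N := N)).differentiableAt (by simp)).hasFDerivAt
  refine h.congr_fderiv ?_
  have h1 := (HasFDerivAt.comp (f := fun e ↦ (e, originPt E N)) (originPt E N) h
    (hasFDerivAt_prodMk_left (originPt E N) (originPt E N))).fderiv
  have h2 := (HasFDerivAt.comp (f := fun e ↦ (originPt E N, e)) (originPt E N) h
    (hasFDerivAt_prodMk_right (originPt E N) (originPt E N))).fderiv
  have e1 := (fderiv_mulChart_left (E := E) (N := N) (y := originPt E N) (by simp)).symm.trans h1
  have e2 := (fderiv_mulChart_right (E := E) (N := N) (y := originPt E N) (by simp)).symm.trans h2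
  have hL : dLeft E (1 : N) = ContinuousLinearMap.id ℝ E := by
    simp only [dLeft, one_mul]; exact dmap_id _
  simp only [param_originPt, dmap_chartOne, dRight_one, hL] at e1 e2
  refine ContinuousLinearMap.prod_ext ?_ ?_
  · rw [← e1]; ext; simp
  · rw [← e2]; ext; simp

/-- To first order at $(1,1)$, multiplication is addition. -/
theorem dmap_mul_one {f g : N → N} (hf : MDifferentiableAt 𝓘(ℝ, E) 𝓘(ℝ, E) f 1)
    (hg : MDifferentiableAt 𝓘(ℝ, E) 𝓘(ℝ, E) g 1) (hf1 : f 1 = 1) (hg1 : g 1 = 1) :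
    (dmap (fun x ↦ f x * g x) 1 : E →L[ℝ] E) = dmap f 1 + dmap g 1 := by
  have hD : ∀ {f : N → N}, MDifferentiableAt 𝓘(ℝ, E) 𝓘(ℝ, E) f 1 → f 1 = 1 →
      HasFDerivAt (fun z ↦ chartOne E N (f (param E N z))) (dmap f 1 : E →L[ℝ] E)
        (originPt E N) ∧ Tendsto (fun z ↦ f (param E N z)) (𝓝 (originPt E N)) (𝓝 1) := by
    intro f hf hf1
    have hf' : MDifferentiableAt 𝓘(ℝ, E) 𝓘(ℝ, E) f (param E N (originPt E N)) := by simpa using hf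
    have hfp : MDifferentiableAt 𝓘(ℝ, E) 𝓘(ℝ, E) (fun z ↦ f (param E N z)) (originPt E N) :=
      hf'.comp _ mdifferentiableAt_param
    constructor
    · rw [dmap_one_eq hf hf1]
      refine DifferentiableAt.hasFDerivAt ?_
      rw [← mdifferentiableAt_iff_differentiableAt]
      exact MDifferentiableAt.comp (g := chartOne E N) _
        (by simpa [hf1] using mdifferentiableAt_chartOne) hfp
    · have := hfp.continuousAt
      simpa [ContinuousAt, hf1] using this
  have hfg : MDifferentiableAt 𝓘(ℝ, E) 𝓘(ℝ, E) (fun x ↦ f x * g x) 1 := by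
    have h1 : MDifferentiableAt (𝓘(ℝ, E).prod 𝓘(ℝ, E)) 𝓘(ℝ, E) (fun p : N × N ↦ p.1 * p.2)
        (f 1, g 1) := ((contMDiff_mul 𝓘(ℝ, E) ∞).mdifferentiable (by simp)) _
    exact h1.comp 1 (hf.prodMk hg)
  obtain ⟨f1, f2⟩ := hD hf hf1
  obtain ⟨g1, g2⟩ := hD hg hg1
  obtain ⟨k1, -⟩ := hD hfg (by simp [hf1, hg1])
  have h0 : ∀ f : N → N, f 1 = 1 → chartOne E N (f (param E N (originPt E N))) = originPt E N := by
    intro f hf; simp [hf]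
  have h1 : HasFDerivAt (fun z ↦ mulChart E N (chartOne E N (f (param E N z)),
      chartOne E N (g (param E N z)))) _ (originPt E N) :=
    HasFDerivAt.comp (originPt E N) (g := mulChart E N)
      (by rw [h0 f hf1, h0 g hg1]; exact hasFDerivAt_mulChart) (f1.prodMk g1)
  refine k1.unique (HasFDerivAt.congr_fderiv (h1.congr_of_eventuallyEq ?_) ?_)
  · filter_upwards [f2.eventually (eventually_param_chartOne (E := E)),
      g2.eventually (eventually_param_chartOne (E := E))] with z hz hz'
    simp only [mulChart, hz, hz']
  · ext v
    simp

theorem mdifferentiable_inv :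
    MDifferentiable 𝓘(ℝ, E) 𝓘(ℝ, E) (fun x : N ↦ x⁻¹) :=
  (contMDiff_inv 𝓘(ℝ, E) ∞).mdifferentiable (by simp)

theorem dmap_inv_one : (dmap (fun x : N ↦ x⁻¹) 1 : E →L[ℝ] E) = - ContinuousLinearMap.id ℝ E := by
  have h := dmap_mul_one (f := fun x : N ↦ x) (g := fun x : N ↦ x⁻¹)
    mdifferentiableAt_id (mdifferentiable_inv (E := E) 1) rfl inv_one
  simp only [mul_inv_cancel, dmap_const, dmap_id] at h
  exact (neg_eq_of_add_eq_zero_right h.symm).symm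

/-- The derivative of the commutator with a fixed element. -/
theorem dmap_comm_comp {f : N → N} (hf : MDifferentiableAt 𝓘(ℝ, E) 𝓘(ℝ, E) f 1) (hf1 : f 1 = 1)
    (a : N) : MDifferentiableAt 𝓘(ℝ, E) 𝓘(ℝ, E) (fun x ↦ a * f x * a⁻¹ * (f x)⁻¹) 1 ∧
    (dmap (fun x ↦ a * f x * a⁻¹ * (f x)⁻¹) 1 : E →L[ℝ] E) = (Ad E a - 1) * dmap f 1 := by
  have h1 : MDifferentiableAt 𝓘(ℝ, E) 𝓘(ℝ, E) (fun x ↦ a * f x * a⁻¹) 1 :=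
    (mdifferentiable_conj E a (f 1)).comp 1 hf
  have h2 : MDifferentiableAt 𝓘(ℝ, E) 𝓘(ℝ, E) (fun x ↦ (f x)⁻¹) 1 :=
    (mdifferentiable_inv (E := E) (f 1)).comp 1 hf
  constructor
  · have h3 : MDifferentiableAt (𝓘(ℝ, E).prod 𝓘(ℝ, E)) 𝓘(ℝ, E) (fun p : N × N ↦ p.1 * p.2)
        (a * f 1 * a⁻¹, (f 1)⁻¹) := ((contMDiff_mul 𝓘(ℝ, E) ∞).mdifferentiable (by simp)) _
    exact h3.comp 1 (h1.prodMk h2)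
  · rw [dmap_mul_one h1 h2 (by simp [hf1]) (by simp [hf1]),
      dmap_comp_one (g := fun x ↦ a * x * a⁻¹) (mdifferentiable_conj E a 1) hf hf1,
      dmap_comp_one (g := fun x ↦ x⁻¹) (mdifferentiable_inv 1) hf hf1, dmap_inv_one]
    ext v
    simp [Ad, sub_eq_add_neg]

theorem dmap_iterComm (l : List N) : MDifferentiableAt 𝓘(ℝ, E) 𝓘(ℝ, E) (iterComm l) 1 ∧
    (dmap (iterComm l) 1 : E →L[ℝ] E) = (l.map fun a ↦ Ad E a - 1).prod := by
  induction l with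
  | nil => exact ⟨mdifferentiableAt_id, dmap_id _⟩
  | cons a l ih =>
    have h := dmap_comm_comp ih.1 (iterComm_one l) a
    refine ⟨h.1, h.2.trans ?_⟩
    rw [ih.2, List.map_cons, List.prod_cons]

/-- For a nilpotent Lie group, long products of operators `ad X` vanish. -/
theorem exists_prod_ad_eq_zero (hN : Group.IsNilpotent N) :
    ∃ c : ℕ, ∀ l : List E, l.length = c → (l.map (ad E N)).prod = 0 := by
  obtain ⟨c, hc⟩ := Subgroup.nilpotent_iff_lowerCentralSeries.mp hN
  -- Group elements are exchanged for Lie algebra elements one at a time. With group elements only,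
  -- the product is the derivative of a trivial iterated commutator; differentiating
  -- $P(\mathrm{Ad}(y)-1)Qv=0$ at $y=1$ turns the last factor $\mathrm{Ad}(y)-1$ into
  -- $\mathrm{ad}\,X$.
  have key : ∀ (l₂ : List E) (l₁ : List N), l₁.length + l₂.length = c →
      (l₁.map fun a ↦ Ad E a - 1).prod * (l₂.map (ad E N)).prod = 0 := by
    intro l₂
    induction l₂ with
    | nil =>
      intro l₁ hl
      have h1 : iterComm l₁ = fun _ ↦ 1 := by
        ext b
        have := iterComm_mem l₁ b
        rw [show l₁.length = c by simpa using hl, hc] at this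
        exact Subgroup.mem_bot.mp this
      rw [← (dmap_iterComm l₁).2, h1, dmap_const, zero_mul]
    | cons X l₂ ih =>
      intro l₁ hl
      set P := (l₁.map fun a ↦ Ad E a - 1).prod
      set Q := (l₂.map (ad E N)).prod with hQ
      ext v
      have h1 : HasFDerivAt (fun y ↦ P (Ad E (param E N y) (Q v) - Q v)) _ (originPt E N) :=
        P.hasFDerivAt.comp (originPt E N) (((hasFDerivAt_Ad (E := E) (N := N)).clm_apply
          (hasFDerivAt_const (Q v) (originPt E N))).sub_const (Q v))
      have h2 := h1.unique ((hasFDerivAt_const (0 : E) (originPt E N)).congr_of_eventuallyEq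
        (Eventually.of_forall fun y ↦ by
          have := ih (l₁ ++ [param E N y]) (by simp at hl ⊢; omega)
          rw [List.map_append, List.prod_append] at this
          simpa using DFunLike.congr_fun this v))
      simpa using DFunLike.congr_fun h2 X
  exact ⟨c, fun l hl ↦ by simpa using key l [] (by simpa using hl)⟩

end LieGroupAlgebra

/-! ### Maps with zero derivative -/

section LocallyConstant

open Filter Topology

variable {E : Type*} [NormedAddCommGroup E] [NormedSpace ℝ E]
  {M : Type*} [TopologicalSpace M] [ChartedSpace E M] [IsManifold 𝓘(ℝ, E) ∞ M]
  {E' : Type*} [NormedAddCommGroup E'] [NormedSpace ℝ E']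
  {M' : Type*} [TopologicalSpace M'] [ChartedSpace E' M'] [IsManifold 𝓘(ℝ, E') ∞ M']

/-- On a connected manifold, a map with zero derivative is constant. -/
theorem eq_of_dmap_eq_zero [ConnectedSpace M] {f : M → M'}
    (hf : MDifferentiable 𝓘(ℝ, E) 𝓘(ℝ, E') f) (h0 : ∀ x, (dmap f x : E →L[ℝ] E') = 0) (x y : M) :
    f x = f y := by
  refine IsLocallyConstant.apply_eq_of_preconnectedSpace ?_ x y
  refine (IsLocallyConstant.iff_eventually_eq f).mpr fun x ↦ ?_
  set e := extChartAt 𝓘(ℝ, E) x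
  set e' := extChartAt 𝓘(ℝ, E') (f x)
  have hcont : ContinuousAt (fun z ↦ f (e.symm z)) (e x) := by
    refine ContinuousAt.comp (g := f) ?_ (continuousAt_extChartAt_symm x)
    rw [extChartAt_to_inv]; exact hf.continuous.continuousAt
  have hsrc : ∀ᶠ z in 𝓝 (e x), z ∈ e.target ∧ f (e.symm z) ∈ e'.source := by
    have h1 : ∀ᶠ z in 𝓝 (e x), z ∈ e.target :=
      (isOpen_extChartAt_target (I := 𝓘(ℝ, E)) x).mem_nhds (mem_extChartAt_target x)
    refine h1.and (hcont.eventually ?_)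
    simp only [e, extChartAt_to_inv]
    exact (isOpen_extChartAt_source (I := 𝓘(ℝ, E')) (f x)).mem_nhds (mem_extChartAt_source _)
  obtain ⟨r, hr, hball⟩ := Metric.eventually_nhds_iff_ball.mp hsrc
  have hmd : ∀ z ∈ Metric.ball (e x) r,
      MDifferentiableAt 𝓘(ℝ, E) 𝓘(ℝ, E') (fun z ↦ f (e.symm z)) z := fun z hz ↦
    (hf _).comp z (mdifferentiableAt_ext_symm (hball z hz).1)
  have hmd' : ∀ z ∈ Metric.ball (e x) r,
      MDifferentiableAt 𝓘(ℝ, E) 𝓘(ℝ, E') (fun z ↦ e' (f (e.symm z))) z := fun z hz ↦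
    MDifferentiableAt.comp (g := e') z (mdifferentiableAt_ext (hball z hz).2) (hmd z hz)
  have hd : DifferentiableOn ℝ (fun z ↦ e' (f (e.symm z))) (Metric.ball (e x) r) := fun z hz ↦
    (mdifferentiableAt_iff_differentiableAt.mp (hmd' z hz)).differentiableWithinAt
  have hzero : ∀ z ∈ Metric.ball (e x) r,
      fderivWithin ℝ (fun z ↦ e' (f (e.symm z))) (Metric.ball (e x) r) z = 0 := by
    intro z hz
    rw [fderivWithin_of_isOpen Metric.isOpen_ball hz, ← dmap_eq_fderiv,
      dmap_comp (g := e') (f := fun z ↦ f (e.symm z)) (mdifferentiableAt_ext (hball z hz).2) (hmd z hz),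
      dmap_comp (g := f) (f := e.symm) (hf _) (mdifferentiableAt_ext_symm (hball z hz).1), h0]
    simp
  filter_upwards [(continuousAt_extChartAt (I := 𝓘(ℝ, E)) x).eventually
    (Metric.ball_mem_nhds (e x) hr), eventually_ext_symm_left
      (mem_extChartAt_source (I := 𝓘(ℝ, E)) x)] with x' h1 h2
  have h3 := (convex_ball (e x) r).is_const_of_fderivWithin_eq_zero hd hzero h1
    (Metric.mem_ball_self hr)
  have h4 := (hball _ h1).2
  simp only [e] at h3 h4
  rw [h2] at h3 h4
  rw [extChartAt_to_inv] at h3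
  exact e'.injOn h4 (mem_extChartAt_source _) h3

end LocallyConstant

/-! ### From the Lie algebra back to the connected group -/

section TwoStep

open scoped commutatorElement

open Filter Topology

variable {E : Type*} [NormedAddCommGroup E] [NormedSpace ℝ E]
  {N : Type*} [TopologicalSpace N] [ChartedSpace E N] [Group N] [LieGroup 𝓘(ℝ, E) ∞ N]

/-- An element of a connected Lie group which acts trivially in the adjoint representation is
central. -/
theorem mem_center_of_Ad_eq_one [ConnectedSpace N] {z : N}
    (hz : Ad E z = ContinuousLinearMap.id ℝ E) : z ∈ Subgroup.center N := by
  set f : N → N := fun x ↦ z * x * z⁻¹ * x⁻¹ with hf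
  have hfd : MDifferentiable 𝓘(ℝ, E) 𝓘(ℝ, E) f := by
    intro x
    have h3 : MDifferentiableAt (𝓘(ℝ, E).prod 𝓘(ℝ, E)) 𝓘(ℝ, E) (fun p : N × N ↦ p.1 * p.2)
        (z * x * z⁻¹, x⁻¹) := ((contMDiff_mul 𝓘(ℝ, E) ∞).mdifferentiable (by simp)) _
    exact h3.comp x ((mdifferentiable_conj E z x).prodMk (mdifferentiable_inv (E := E) x))
  have h1 : (dmap f 1 : E →L[ℝ] E) = 0 := by
    have h := (dmap_comm_comp (f := fun x : N ↦ x) (mdifferentiableAt_id (I := 𝓘(ℝ, E))) rfl z).2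
    rw [hf, h, hz]
    change (1 - 1) * _ = _
    simp
  have h0 : ∀ x, (dmap f x : E →L[ℝ] E) = 0 := by
    intro x
    -- This cocycle identity for the commutator carries the vanishing of the derivative from 1 to
    -- every point $x$.
    have e : f = fun y ↦ (fun w ↦ z * x * z⁻¹ * w * x⁻¹) (f (x⁻¹ * y)) := by
      ext y; simp [hf]; group
    have hA : MDifferentiable 𝓘(ℝ, E) 𝓘(ℝ, E) (fun w : N ↦ z * x * z⁻¹ * w * x⁻¹) :=
      (mdifferentiable_rightMul E x⁻¹).comp (mdifferentiable_leftMul E (z * x * z⁻¹))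
    rw [e, dmap_comp (g := fun w ↦ z * x * z⁻¹ * w * x⁻¹) (f := fun y ↦ f (x⁻¹ * y)) (hA _) ((hfd _).comp x (mdifferentiable_leftMul E x⁻¹ x)),
      dmap_comp (g := f) (f := fun y ↦ x⁻¹ * y) (hfd _) (mdifferentiable_leftMul E x⁻¹ x), inv_mul_cancel, h1]
    simp
  refine Subgroup.mem_center_iff.mpr fun x ↦ ?_
  have h2 := eq_of_dmap_eq_zero hfd h0 x 1
  simp only [hf, mul_one, mul_inv_cancel, inv_one] at h2
  rw [mul_inv_eq_one, mul_inv_eq_iff_eq_mul] at h2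
  exact h2.symm

/-- The derivative of an orbit map of the adjoint representation. -/
theorem mdifferentiableAt_Ad_apply (a : N) (W : E) :
    MDifferentiableAt 𝓘(ℝ, E) 𝓘(ℝ, E) (fun x : N ↦ Ad E x W) a ∧
    ∀ v, ∃ X, (dmap (fun x : N ↦ Ad E x W) a : E →L[ℝ] E) v = Ad E a (ad E N X W) := by
  have hone : HasFDerivAt (fun y ↦ Ad E (param E N y) W) ((ad E N).flip W) (originPt E N) := by
    refine ((hasFDerivAt_Ad (E := E) (N := N)).clm_apply
      (hasFDerivAt_const W (originPt E N))).congr_fderiv ?_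
    ext v; simp
  have hone' : HasFDerivAt (fun y ↦ Ad E a (Ad E (param E N y) W))
      ((Ad E a).comp ((ad E N).flip W)) (originPt E N) :=
    (Ad E a).hasFDerivAt.comp (originPt E N) hone
  have hmd : MDifferentiableAt 𝓘(ℝ, E) 𝓘(ℝ, E) (fun y ↦ Ad E a (Ad E (param E N y) W))
      (chartOne E N (a⁻¹ * a)) := by
    rw [inv_mul_cancel, chartOne_one, mdifferentiableAt_iff_differentiableAt]
    exact hone'.differentiableAt
  have hinner : MDifferentiableAt 𝓘(ℝ, E) 𝓘(ℝ, E) (fun x : N ↦ chartOne E N (a⁻¹ * x)) a :=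
    MDifferentiableAt.comp (g := chartOne E N) a
      (by rw [inv_mul_cancel]; exact mdifferentiableAt_chartOne) (mdifferentiable_leftMul E a⁻¹ a)
  have heq : (fun x : N ↦ Ad E x W) =ᶠ[𝓝 a]
      fun x ↦ Ad E a (Ad E (param E N (chartOne E N (a⁻¹ * x))) W) := by
    have hc : Tendsto (fun x : N ↦ a⁻¹ * x) (𝓝 a) (𝓝 1) := by
      have := (mdifferentiable_leftMul E a⁻¹ a).continuousAt
      simpa [ContinuousAt] using this
    filter_upwards [hc.eventually (eventually_param_chartOne (E := E))] with x hx
    rw [hx, ← ContinuousLinearMap.comp_apply, ← Ad_mul, mul_inv_cancel_left]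
  constructor
  · exact (MDifferentiableAt.comp (g := fun y ↦ Ad E a (Ad E (param E N y) W))
      (f := fun x ↦ chartOne E N (a⁻¹ * x)) a hmd hinner).congr_of_eventuallyEq heq
  · intro v
    refine ⟨(dmap (fun x : N ↦ chartOne E N (a⁻¹ * x)) a : E →L[ℝ] E) v, ?_⟩
    rw [dmap_congr heq, dmap_comp_apply (g := fun y ↦ Ad E a (Ad E (param E N y) W))
      (f := fun x ↦ chartOne E N (a⁻¹ * x)) hmd hinner,
      inv_mul_cancel, chartOne_one, dmap_eq_fderiv, hone'.fderiv]
    simp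

/-- A connected Lie group with 2-step nilpotent Lie algebra is at most 2-step nilpotent. -/
theorem nilpotencyClass_le_two [ConnectedSpace N] (hN : Group.IsNilpotent N)
    (h : ∀ X Y Z : E, ad E N X (ad E N Y Z) = 0) :
    Group.nilpotencyClass N ≤ 2 := by
  -- On brackets the orbit map of $\mathrm{Ad}$ has derivative $\mathrm{Ad}(x)[X,[Y,Z]]=0$, so it is
  -- constant.
  have hder : ∀ (a : N) (Y Z : E), Ad E a (ad E N Y Z) = ad E N Y Z := by
    intro a Y Z
    have h1 := eq_of_dmap_eq_zero (f := fun x : N ↦ Ad E x (ad E N Y Z))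
      (fun x ↦ (mdifferentiableAt_Ad_apply x _).1) (fun x ↦ by
        ext v
        obtain ⟨X, hX⟩ := (mdifferentiableAt_Ad_apply x (ad E N Y Z)).2 v
        rw [hX, h, map_zero]; rfl) a 1
    simpa [Ad_one] using h1
  -- The derivative of $x\mapsto(\mathrm{Ad}(b)-1)\mathrm{Ad}(x)W$ consists of brackets acted on by
  -- $\mathrm{Ad}(b)-1$, hence is 0. So
  -- $\mathrm{Ad}(b)\mathrm{Ad}(a)=\mathrm{Ad}(a)+\mathrm{Ad}(b)-1$, which is symmetric in $a,b$.
  have hcomm : ∀ (a b : N) (W : E), Ad E b (Ad E a W) - Ad E a W = Ad E b W - W := by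
    intro a b W
    have hd : ∀ x : N, MDifferentiableAt 𝓘(ℝ, E) 𝓘(ℝ, E) (fun v : E ↦ Ad E b v - v)
        (Ad E x W) := fun x ↦
      mdifferentiableAt_iff_differentiableAt.mpr (by fun_prop)
    have h1 := eq_of_dmap_eq_zero (f := fun x : N ↦ (fun v : E ↦ Ad E b v - v) (Ad E x W))
      (fun x ↦ (hd x).comp x (mdifferentiableAt_Ad_apply x W).1) (fun x ↦ by
        ext v
        obtain ⟨X, hX⟩ := (mdifferentiableAt_Ad_apply x W).2 v
        rw [dmap_comp_apply (g := fun v : E ↦ Ad E b v - v)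
          (f := fun x : N ↦ Ad E x W) (hd x) (mdifferentiableAt_Ad_apply x W).1, hX, dmap_eq_fderiv,
          fderiv_fun_sub (by fun_prop) (by fun_prop), ContinuousLinearMap.fderiv]
        simp [hder]) a 1
    simpa [Ad_one] using h1
  have hcen : ∀ a b : N, ⁅a, b⁆ ∈ Subgroup.center N := by
    intro a b
    refine mem_center_of_Ad_eq_one (E := E) ?_
    have hab : Ad E (a * b) = Ad E (b * a) := by
      ext W
      have h1 := hcomm a b W
      have h2 := hcomm b a W
      rw [Ad_mul, Ad_mul, ContinuousLinearMap.comp_apply, ContinuousLinearMap.comp_apply,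
        sub_eq_iff_eq_add.mp h1, sub_eq_iff_eq_add.mp h2]
      abel
    rw [commutatorElement_def, show a * b * a⁻¹ * b⁻¹ = (a * b) * (b * a)⁻¹ by group, Ad_mul, hab,
      ← Ad_mul, mul_inv_cancel, Ad_one]
  rw [← Subgroup.upperCentralSeries_eq_top_iff_nilpotencyClass_le, eq_top_iff]
  intro a _
  refine Subgroup.mem_upperCentralSeries_succ_iff.mpr fun b ↦ ?_
  rw [Subgroup.upperCentralSeries_one]
  exact hcen a b

end TwoStep

/-! ### Momenta of right-invariant fields and geodesics -/

section Momentum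

open Filter Topology

variable {E : Type*} [NormedAddCommGroup E] [NormedSpace ℝ E]
  {N : Type*} [TopologicalSpace N] [ChartedSpace E N] [Group N] [LieGroup 𝓘(ℝ, E) ∞ N]

variable (E) in
/-- The action of the group by left multiplication, in the chart around `1` for the group element
and the chart around `x₁` for the point. -/
def actChart (x₁ : N) (p : E × E) : E :=
  extChartAt 𝓘(ℝ, E) x₁ (param E N p.1 * (extChartAt 𝓘(ℝ, E) x₁).symm p.2)

theorem contDiffAt_actChart {x₁ : N} {y : E} (hy : y ∈ (extChartAt 𝓘(ℝ, E) x₁).target) :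
    ContDiffAt ℝ ∞ (actChart E x₁) (originPt E N, y) :=
  contDiffAt_mul_chart x₁ hy

theorem actChart_origin {x₁ : N} {y : E} (hy : y ∈ (extChartAt 𝓘(ℝ, E) x₁).target) :
    actChart E x₁ (originPt E N, y) = y := by
  simp only [actChart, param_originPt, one_mul]
  exact (extChartAt 𝓘(ℝ, E) x₁).right_inv hy

/-- The infinitesimal generators of left multiplications are the right-invariant vector fields. -/
theorem fderiv_actChart_left {x₁ : N} {y : E} (hy : y ∈ (extChartAt 𝓘(ℝ, E) x₁).target) (K : E) :
    fderiv ℝ (actChart E x₁) (originPt E N, y) (K, 0)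
      = (dmap (extChartAt 𝓘(ℝ, E) x₁) ((extChartAt 𝓘(ℝ, E) x₁).symm y) : E →L[ℝ] E)
        (dRight E ((extChartAt 𝓘(ℝ, E) x₁).symm y) K) := by
  have h := ((contDiffAt_actChart hy).differentiableAt (by simp)).hasFDerivAt
  have h1 := HasFDerivAt.comp (f := fun e ↦ (e, y)) (originPt E N) h
    (hasFDerivAt_prodMk_left (originPt E N) y)
  set x := (extChartAt 𝓘(ℝ, E) x₁).symm y
  have hx : x ∈ (extChartAt 𝓘(ℝ, E) x₁).source := (extChartAt 𝓘(ℝ, E) x₁).map_target hy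
  have h2 : MDifferentiableAt 𝓘(ℝ, E) 𝓘(ℝ, E) (fun a : N ↦ a * x)
    (param E N (originPt E N)) := mdifferentiable_rightMul E _ _
  have h3 := dmap_comp_apply (g := extChartAt 𝓘(ℝ, E) x₁) (f := fun z ↦ param E N z * x)
    (x := originPt E N) (by simpa using mdifferentiableAt_ext hx)
    (h2.comp (originPt E N) mdifferentiableAt_param) K
  rw [dmap_comp_apply (g := fun a : N ↦ a * x) h2 mdifferentiableAt_param, dmap_param,
    param_originPt, one_mul, dmap_eq_fderiv] at h3
  rw [← ContinuousLinearMap.inl_apply (R := ℝ) (M₁ := E) (M₂ := E), ← ContinuousLinearMap.comp_apply,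
    ← h1.fderiv]
  exact h3

theorem dRight_surjective (x : N) (v : E) : ∃ K, dRight E x K = v := by
  have h := dmap_comp_apply (g := fun a : N ↦ a * x) (f := fun a ↦ a * x⁻¹) (x := x)
    (mdifferentiable_rightMul E _ _) (mdifferentiable_rightMul E _ _) v
  simp only [inv_mul_cancel_right, dmap_id, mul_inv_cancel] at h
  exact ⟨_, h.symm⟩

namespace PseudoRiemannianMetric

variable (g : PseudoRiemannianMetric E N)

/-- Left multiplications are isometries. -/
def IsLeftInvariant : Prop :=
  ∀ (a x : N) (v w : E), g.form (a * x) ((dmap (fun y ↦ a * y) x : E →L[ℝ] E) v)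
    ((dmap (fun y ↦ a * y) x : E →L[ℝ] E) w) = g.form x v w

variable {g}

theorem coord_fderiv_actChart {x₁ : N} {y : E} (hy : y ∈ (extChartAt 𝓘(ℝ, E) x₁).target)
    (w K : E) : g.coord x₁ y w (fderiv ℝ (actChart E x₁) (originPt E N, y) (K, 0))
      = g.form ((extChartAt 𝓘(ℝ, E) x₁).symm y)
        ((dmap (extChartAt 𝓘(ℝ, E) x₁).symm y : E →L[ℝ] E) w)
        (dRight E ((extChartAt 𝓘(ℝ, E) x₁).symm y) K) := by
  have h := dmap_symm_dmap_ext ((extChartAt 𝓘(ℝ, E) x₁).map_target hy)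
    (dRight E ((extChartAt 𝓘(ℝ, E) x₁).symm y) K)
  rw [(extChartAt 𝓘(ℝ, E) x₁).right_inv hy] at h
  rw [coord_apply, fderiv_actChart_left hy, h]

/-- The chart form of left multiplication being isometric, as required of the family in the
conservation law. It holds only near the origin, where the translated point stays in the chart. -/
theorem IsLeftInvariant.coord_actChart (hg : g.IsLeftInvariant) {x₁ : N} {y : E}
    (hy : y ∈ (extChartAt 𝓘(ℝ, E) x₁).target) : ∀ᶠ z in 𝓝 (originPt E N), ∀ a,
      g.coord x₁ (actChart E x₁ (z, y)) (fderiv ℝ (actChart E x₁) (z, y) (0, a))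
        (fderiv ℝ (actChart E x₁) (z, y) (0, a)) = g.coord x₁ y a a := by
  have hd : ∀ᶠ q in 𝓝 (originPt E N, y), DifferentiableAt ℝ (actChart E x₁) q :=
    (((contDiffAt_actChart hy).of_le (m := 1) (by norm_cast)).eventually (by simp)).mono
      fun q hq ↦ hq.differentiableAt (by simp)
  have hc : Tendsto (fun z : E ↦ (z, y)) (𝓝 (originPt E N)) (𝓝 (originPt E N, y)) := by
    have : Continuous fun z : E ↦ (z, y) := by fun_prop
    exact this.tendsto _
  set x := (extChartAt 𝓘(ℝ, E) x₁).symm y with hx_def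
  have hx : x ∈ (extChartAt 𝓘(ℝ, E) x₁).source := (extChartAt 𝓘(ℝ, E) x₁).map_target hy
  have hs : ∀ᶠ z in 𝓝 (originPt E N), param E N z * x ∈ (extChartAt 𝓘(ℝ, E) x₁).source := by
    have h1 : ContinuousAt (fun z ↦ param E N z * x) (originPt E N) :=
      ((mdifferentiable_rightMul E x (param E N (originPt E N))).comp (originPt E N)
        mdifferentiableAt_param).continuousAt
    refine h1.eventually ?_
    simp only [param_originPt, one_mul]
    exact (isOpen_extChartAt_source (I := 𝓘(ℝ, E)) x₁).mem_nhds hx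
  filter_upwards [hc.eventually hd, hs] with z hz1 hz2 a
  have h1 := HasFDerivAt.comp (f := fun e ↦ (z, e)) y hz1.hasFDerivAt
    (hasFDerivAt_prodMk_right z y)
  have h2 := dmap_comp_apply (g := extChartAt 𝓘(ℝ, E) x₁)
    (f := fun y ↦ param E N z * (extChartAt 𝓘(ℝ, E) x₁).symm y) (x := y)
    (mdifferentiableAt_ext hz2) ((mdifferentiable_leftMul E (param E N z) x).comp y
      (mdifferentiableAt_ext_symm hy)) a
  rw [dmap_comp_apply (g := fun b : N ↦ param E N z * b) (f := (extChartAt 𝓘(ℝ, E) x₁).symm)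
    (mdifferentiable_leftMul E (param E N z) x) (mdifferentiableAt_ext_symm hy),
    dmap_eq_fderiv] at h2
  have h3 : fderiv ℝ (actChart E x₁) (z, y) (0, a)
      = (dmap (extChartAt 𝓘(ℝ, E) x₁) (param E N z * x) : E →L[ℝ] E)
        ((dmap (fun b : N ↦ param E N z * b) x : E →L[ℝ] E)
          ((dmap (extChartAt 𝓘(ℝ, E) x₁).symm y : E →L[ℝ] E) a)) := by
    rw [← ContinuousLinearMap.inr_apply (R := ℝ) (M₁ := E) (M₂ := E),
      ← ContinuousLinearMap.comp_apply, ← h1.fderiv]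
    exact h2
  rw [coord_apply, coord_apply, h3]
  change g.form ((extChartAt 𝓘(ℝ, E) x₁).symm (extChartAt 𝓘(ℝ, E) x₁ (param E N z * x)))
    ((dmap (extChartAt 𝓘(ℝ, E) x₁).symm (extChartAt 𝓘(ℝ, E) x₁ (param E N z * x)) : E →L[ℝ] E) _)
    ((dmap (extChartAt 𝓘(ℝ, E) x₁).symm (extChartAt 𝓘(ℝ, E) x₁ (param E N z * x)) : E →L[ℝ] E) _)
    = _
  rw [dmap_symm_dmap_ext hz2, (extChartAt 𝓘(ℝ, E) x₁).left_inv hz2, hg]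

/-- A curve with constant momenta for the right-invariant vector fields is a geodesic. -/
theorem IsLeftInvariant.isGeodesicOn [FiniteDimensional ℝ E] (hg : g.IsLeftInvariant) {γ : ℝ → N}
    {J : Set ℝ} (hJ : IsOpen J) (hγ : ContMDiffOn 𝓘(ℝ, ℝ) 𝓘(ℝ, E) 2 γ J) {μ : E → ℝ}
    (hμ : ∀ s ∈ J, ∀ K, g.form (γ s) ((dmap γ s : ℝ →L[ℝ] E) 1) (dRight E (γ s) K) = μ K) :
    g.IsGeodesicOn γ J := by
  refine ⟨hγ, fun t ht v ↦ ?_⟩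
  set x₁ := γ t with hx₁
  set u : ℝ → E := fun s ↦ extChartAt 𝓘(ℝ, E) x₁ (γ s) with hu_def
  have hγt : ContMDiffAt 𝓘(ℝ, ℝ) 𝓘(ℝ, E) 2 γ t := hγ.contMDiffAt (hJ.mem_nhds ht)
  have hut : u t = extChartAt 𝓘(ℝ, E) x₁ x₁ := rfl
  have hy₀ : extChartAt 𝓘(ℝ, E) x₁ x₁ ∈ (extChartAt 𝓘(ℝ, E) x₁).target := mem_extChartAt_target _
  have hu : ContDiffAt ℝ 2 u t := by
    rw [← contMDiffAt_iff_contDiffAt]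
    exact ContMDiffAt.comp t ((contMDiffAt_extChartAt_of_mem (mem_extChartAt_source _)).of_le
      (WithTop.coe_le_coe.mpr le_top)) hγt
  -- Right-invariant fields span each tangent space, so every component $v$ of the geodesic equation
  -- is the conservation of one momentum.
  obtain ⟨K, hK⟩ := dRight_surjective (E := E) x₁ v
  have hKv : fderiv ℝ (actChart E x₁) (originPt E N, extChartAt 𝓘(ℝ, E) x₁ x₁) (K, 0) = v := by
    rw [fderiv_actChart_left hy₀, extChartAt_to_inv, hK, dmap_ext_self]
    rfl
  have hcons : ∀ᶠ s in 𝓝 t, g.coord x₁ (u s) (deriv u s)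
      (fderiv ℝ (actChart E x₁) (originPt E N, u s) (K, 0)) = μ K := by
    have h1 : ∀ᶠ s in 𝓝 t, γ s ∈ (extChartAt 𝓘(ℝ, E) x₁).source :=
      hγt.continuousAt.eventually
        ((isOpen_extChartAt_source (I := 𝓘(ℝ, E)) x₁).mem_nhds (mem_extChartAt_source _))
    filter_upwards [h1, hJ.mem_nhds ht] with s hs1 hs2
    have h2 : deriv u s = (dmap (extChartAt 𝓘(ℝ, E) x₁) (γ s) : E →L[ℝ] E)
        ((dmap γ s : ℝ →L[ℝ] E) 1) := by
      rw [← fderiv_apply_one_eq_deriv, ← dmap_eq_fderiv]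
      exact dmap_comp_apply (mdifferentiableAt_ext hs1)
        ((hγ.contMDiffAt (hJ.mem_nhds hs2)).mdifferentiableAt (by simp)) 1
    have h3 : u s = extChartAt 𝓘(ℝ, E) x₁ (γ s) := rfl
    rw [coord_fderiv_actChart (by rw [h3]; exact (extChartAt 𝓘(ℝ, E) x₁).map_source hs1), h2, h3,
      dmap_symm_dmap_ext hs1, (extChartAt 𝓘(ℝ, E) x₁).left_inv hs1, hμ s hs2]
  have hid : ∀ᶠ y in 𝓝 (extChartAt 𝓘(ℝ, E) x₁ x₁), actChart E x₁ (originPt E N, y) = y := by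
    filter_upwards [(isOpen_extChartAt_target (I := 𝓘(ℝ, E)) x₁).mem_nhds hy₀] with y hy
    exact actChart_origin hy
  have key := geodesic_equation_of_momentum (contDiffAt_actChart hy₀) hid
    ((g.contDiffAt_coord x₁ hy₀).differentiableAt (by simp)) (fun v w ↦ g.coord_symm x₁ _ v w)
    (hg.coord_actChart hy₀) K hu hut hcons
  rw [hKv] at key
  exact key

end PseudoRiemannianMetric

end Momentum

/-! ### Geodesics as solutions of a first-order equation -/

section GeodesicExistence

open Filter Topology

variable {E : Type*} [NormedAddCommGroup E] [NormedSpace ℝ E]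

/-- A twice differentiable local solution of an autonomous differential equation. -/
theorem exists_solution_contDiffOn_two [CompleteSpace E] {f : E → E} {z₀ : E}
    (hf : ContDiffAt ℝ ∞ f z₀) {p : E → Prop} (hp : ∀ᶠ y in 𝓝 z₀, p y) :
    ∃ ε > 0, ∃ u : ℝ → E, u 0 = z₀ ∧ ContDiffOn ℝ 2 u (Set.Ioo (-ε) ε) ∧
      ∀ t ∈ Set.Ioo (-ε) ε, HasDerivAt u (f (u t)) t ∧ p (u t) := by
  have hf1 : ContDiffAt ℝ 1 f z₀ := hf.of_le (by norm_cast)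
  obtain ⟨u, hu0, ε₁, hε₁, hu⟩ :=
    hf1.exists_forall_mem_closedBall_exists_eq_forall_mem_Ioo_hasDerivAt₀ 0
  simp only [zero_sub, zero_add] at hu
  have hcu : ContinuousAt u 0 := (hu 0 ⟨by linarith, hε₁⟩).continuousAt
  have hev : ∀ᶠ t in 𝓝 (0 : ℝ), p (u t) ∧ ContDiffAt ℝ 1 f (u t) :=
    hcu.eventually (by rw [hu0]; exact hp.and (hf1.eventually (by simp)))
  obtain ⟨ε₂, hε₂, hball⟩ := Metric.eventually_nhds_iff.mp hev
  have hsub : ∀ t ∈ Set.Ioo (-(min ε₁ ε₂)) (min ε₁ ε₂),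
      HasDerivAt u (f (u t)) t ∧ p (u t) ∧ ContDiffAt ℝ 1 f (u t) := by
    intro t ht
    have h1 : |t| < min ε₁ ε₂ := abs_lt.mpr ht
    refine ⟨hu t (abs_lt.mp (h1.trans_le (min_le_left _ _))), hball ?_⟩
    rw [Real.dist_eq, sub_zero]
    exact h1.trans_le (min_le_right _ _)
  have hopen : IsOpen (Set.Ioo (-(min ε₁ ε₂)) (min ε₁ ε₂)) := isOpen_Ioo
  have hdiff : DifferentiableOn ℝ u (Set.Ioo (-(min ε₁ ε₂)) (min ε₁ ε₂)) :=
    fun t ht ↦ (hsub t ht).1.differentiableAt.differentiableWithinAt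
  have hderiv : ∀ t ∈ Set.Ioo (-(min ε₁ ε₂)) (min ε₁ ε₂), deriv u t = f (u t) :=
    fun t ht ↦ (hsub t ht).1.deriv
  -- Bootstrap through $u'=f(u)$: continuity of $u$ gives $C^1$, and then $C^2$.
  have hC1 : ContDiffOn ℝ 1 u (Set.Ioo (-(min ε₁ ε₂)) (min ε₁ ε₂)) := by
    rw [show (1 : WithTop ℕ∞) = 0 + 1 by norm_num, contDiffOn_succ_iff_deriv_of_isOpen hopen]
    refine ⟨hdiff, by simp, contDiffOn_zero.mpr (ContinuousOn.congr (fun t ht ↦ ?_) hderiv)⟩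
    exact ((hsub t ht).2.2.continuousAt.comp (hsub t ht).1.continuousAt).continuousWithinAt
  have hC2 : ContDiffOn ℝ 2 u (Set.Ioo (-(min ε₁ ε₂)) (min ε₁ ε₂)) := by
    rw [show (2 : WithTop ℕ∞) = 1 + 1 by norm_num, contDiffOn_succ_iff_deriv_of_isOpen hopen]
    refine ⟨hdiff, by simp, ContDiffOn.congr (fun t ht ↦ ?_) hderiv⟩
    exact (hsub t ht).2.2.comp_contDiffWithinAt t (hC1 t ht)
  exact ⟨min ε₁ ε₂, lt_min hε₁ hε₂, u, hu0, hC2, fun t ht ↦ ⟨(hsub t ht).1, (hsub t ht).2.1⟩⟩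

theorem isInvertible_of_separating [FiniteDimensional ℝ E] {B : E →L[ℝ] E →L[ℝ] ℝ}
    (hB : ∀ v, (∀ w, B v w = 0) → v = 0) : B.IsInvertible := by
  have hinj : Function.Injective (B : E →ₗ[ℝ] E →L[ℝ] ℝ) :=
    (injective_iff_map_eq_zero _).mpr fun v hv ↦ hB v fun w ↦ by
      change (B : E →ₗ[ℝ] E →L[ℝ] ℝ) v w = 0
      rw [hv]; rfl
  have hrank : Module.finrank ℝ E = Module.finrank ℝ (E →L[ℝ] ℝ) := by
    rw [← (LinearMap.toContinuousLinearMap (𝕜 := ℝ) (E := E) (F' := ℝ)).finrank_eq]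
    exact (Subspace.dual_finrank_eq (K := ℝ) (V := E)).symm
  refine ⟨(LinearEquiv.ofInjectiveOfFinrankEq _ hinj hrank).toContinuousLinearEquiv, ?_⟩
  ext v w
  rfl

namespace PseudoRiemannianMetric

variable {N : Type*} [TopologicalSpace N] [ChartedSpace E N] [Group N] [LieGroup 𝓘(ℝ, E) ∞ N]
  (g : PseudoRiemannianMetric E N)

/-- The momenta for the right-invariant vector fields of a tangent vector, in the chart around
`1`. -/
def momentumChart (y : E) : E →L[ℝ] E →L[ℝ] ℝ :=
  ((ContinuousLinearMap.compL ℝ E E ℝ).flip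
    ((fderiv ℝ (actChart E (1 : N)) (originPt E N, y)).comp
      (ContinuousLinearMap.inl ℝ E E))).comp (g.coord 1 y)

theorem momentumChart_apply {y : E} (hy : y ∈ (extChartAt 𝓘(ℝ, E) (1 : N)).target) (w K : E) :
    g.momentumChart y w K = g.form (param E N y) ((dmap (param E N) y : E →L[ℝ] E) w)
      (dRight E (param E N y) K) := by
  have h : g.momentumChart y w K = g.coord 1 y w
      (fderiv ℝ (actChart E (1 : N)) (originPt E N, y) (K, 0)) := by
    simp only [momentumChart, ContinuousLinearMap.comp_apply, ContinuousLinearMap.flip_apply,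
      ContinuousLinearMap.compL_apply, ContinuousLinearMap.inl_apply]
  rw [h, coord_fderiv_actChart hy]
  rfl

theorem momentumChart_origin (w K : E) :
    g.momentumChart (originPt E N) w K = g.form 1 w K := by
  rw [momentumChart_apply g originPt_mem_target, dmap_param, param_originPt, dRight_one]
  rfl

set_option synthInstance.maxHeartbeats 200000 in
theorem contDiffAt_momentumChart [FiniteDimensional ℝ E] :
    ContDiffAt ℝ ∞ g.momentumChart (originPt E N) := by
  have h1 : ContDiffAt ℝ ∞ (fderiv ℝ (actChart E (1 : N))) (originPt E N, originPt E N) :=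
    (contDiffAt_actChart originPt_mem_target).fderiv_right (by simp)
  have h2 : ContDiffAt ℝ ∞ (fun y ↦ fderiv ℝ (actChart E (1 : N)) (originPt E N, y))
      (originPt E N) :=
    h1.comp (originPt E N) (contDiffAt_const.prodMk contDiffAt_id)
  have h3 : ContDiffAt ℝ ∞ (fun y ↦ (fderiv ℝ (actChart E (1 : N)) (originPt E N, y)).comp
      (ContinuousLinearMap.inl ℝ E E)) (originPt E N) :=
    h2.clm_comp contDiffAt_const
  have h4 : ContDiffAt ℝ ∞ (fun y ↦ (ContinuousLinearMap.compL ℝ E E ℝ).flip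
      ((fderiv ℝ (actChart E (1 : N)) (originPt E N, y)).comp (ContinuousLinearMap.inl ℝ E E)))
      (originPt E N) :=
    contDiffAt_const.clm_apply h3
  exact h4.clm_comp (g.contDiffAt_coord 1 originPt_mem_target)

variable {g}

/-- The geodesic which starts at `1` with velocity `T`, with its momenta. -/
theorem IsLeftInvariant.exists_geodesic [FiniteDimensional ℝ E] (hg : g.IsLeftInvariant) (T : E) :
    ∃ ε > 0, ∃ γ : ℝ → N, γ 0 = 1 ∧ g.IsGeodesicOn γ (Set.Ioo (-ε) ε) ∧
      ∀ s ∈ Set.Ioo (-ε) ε, ∀ K, g.form (γ s) ((dmap γ s : ℝ →L[ℝ] E) 1) (dRight E (γ s) K)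
        = g.form 1 T K := by
  have hinv : (g.momentumChart (originPt E N)).IsInvertible :=
    isInvertible_of_separating fun v hv ↦ g.eq_zero_of_form 1 v fun w ↦ by
      rw [← momentumChart_origin, hv]
  -- At $y$ this is the tangent vector having the same momenta as $T$ has at 1, so the integral
  -- curves have constant momenta.
  set f : E → E := fun y ↦ (g.momentumChart y).inverse (g.momentumChart (originPt E N) T)
    with hf_def
  have hf : ContDiffAt ℝ ∞ f (originPt E N) :=
    ((hinv.contDiffAt_map_inverse (n := ∞)).comp (originPt E N)
      g.contDiffAt_momentumChart).clm_apply contDiffAt_const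
  have hev : ∀ᶠ y in 𝓝 (originPt E N), (g.momentumChart y).IsInvertible := by
    obtain ⟨e, he⟩ := hinv
    have := e.nhds
    rw [he] at this
    filter_upwards [g.contDiffAt_momentumChart.continuousAt.eventually this] with y hy
    exact hy
  obtain ⟨ε, hε, u, hu0, hu2, hu⟩ := exists_solution_contDiffOn_two hf
    (hev.and ((isOpen_extChartAt_target (I := 𝓘(ℝ, E)) (1 : N)).mem_nhds originPt_mem_target))
  have hγ2 : ContMDiffOn 𝓘(ℝ, ℝ) 𝓘(ℝ, E) 2 (fun s ↦ param E N (u s)) (Set.Ioo (-ε) ε) := by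
    have h1 := (contMDiffOn_extChartAt_symm (I := 𝓘(ℝ, E)) (n := ∞) (1 : N)).of_le
      (m := 2) (WithTop.coe_le_coe.mpr le_top)
    exact h1.comp hu2.contMDiffOn fun s hs ↦ (hu s hs).2.2
  have hmom : ∀ s ∈ Set.Ioo (-ε) ε, ∀ K, g.form (param E N (u s))
      ((dmap (fun s ↦ param E N (u s)) s : ℝ →L[ℝ] E) 1) (dRight E (param E N (u s)) K)
        = g.form 1 T K := by
    intro s hs K
    obtain ⟨h1, h2, h3⟩ := hu s hs
    rw [dmap_comp_apply (g := param E N) (f := u) (mdifferentiableAt_ext_symm h3)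
      h1.differentiableAt.mdifferentiableAt, dmap_eq_fderiv, fderiv_apply_one_eq_deriv, h1.deriv,
      ← momentumChart_apply g h3, ← momentumChart_origin, hf_def]
    exact congrArg (fun B : E →L[ℝ] ℝ ↦ B K)
      (h2.self_apply_inverse (g.momentumChart (originPt E N) T))
  exact ⟨ε, hε, fun s ↦ param E N (u s), by simp [hu0], hg.isGeodesicOn isOpen_Ioo hγ2 hmom, hmom⟩

end PseudoRiemannianMetric

end GeodesicExistence

/-! ### Orbits of one-parameter subgroups and the infinitesimal condition -/

section Orbits

open Filter Topology

variable {E : Type*} [NormedAddCommGroup E] [NormedSpace ℝ E]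
  {N : Type*} [TopologicalSpace N] [ChartedSpace E N] [Group N] [LieGroup 𝓘(ℝ, E) ∞ N]
  {F : Type*} [NormedAddCommGroup F] [NormedSpace ℝ F]
  {H : Type*} [TopologicalSpace H] [ChartedSpace F H] [Group H] [LieGroup 𝓘(ℝ, F) ∞ H]
  {φ : H →* MulAut N}

theorem PseudoRiemannianMetric.isLeftInvariant_of_isIsometry {g : PseudoRiemannianMetric E N}
    (hiso : ∀ a : N ⋊[φ] H, g.IsIsometry (cosetAct a)) : g.IsLeftInvariant := by
  intro a x v w
  have h : cosetAct (⟨a, 1⟩ : N ⋊[φ] H) = fun y ↦ a * y := by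
    ext y; simp [cosetAct]
  have := hiso ⟨a, 1⟩ x v w
  rw [h] at this
  exact this

theorem form_dmap_of_isIsometry {g : PseudoRiemannianMetric E N}
    (hiso : ∀ a : N ⋊[φ] H, g.IsIsometry (cosetAct a)) (b : H) (v w : E) :
    g.form 1 ((dmap (φ b) 1 : E →L[ℝ] E) v) ((dmap (φ b) 1 : E →L[ℝ] E) w) = g.form 1 v w := by
  have h : cosetAct (⟨1, b⟩ : N ⋊[φ] H) = φ b := by
    ext y; simp [cosetAct]
  have := hiso ⟨1, b⟩ 1 v w
  rw [h] at this
  have h1 : φ b 1 = 1 := map_one _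
  change g.form (φ b 1) _ _ = _ at this
  rw [h1] at this
  exact this

theorem mdifferentiable_action
    (hφ : ContMDiff (𝓘(ℝ, F).prod 𝓘(ℝ, E)) 𝓘(ℝ, E) ∞ fun p : H × N ↦ φ p.1 p.2) (b : H) :
    MDifferentiable 𝓘(ℝ, E) 𝓘(ℝ, E) (φ b) :=
  (hφ.comp (contMDiff_const (c := b) |>.prodMk contMDiff_id)).mdifferentiable (by simp)

namespace OneParameterSubgroup

variable (c : OneParameterSubgroup E F φ)

/-- The component in `N` of a one-parameter subgroup of `N ⋊ H`. -/
def left (τ : ℝ) : N := (c.hom (Multiplicative.ofAdd τ)).left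

/-- The component in `H` of a one-parameter subgroup of `N ⋊ H`. -/
def right (τ : ℝ) : H := (c.hom (Multiplicative.ofAdd τ)).right

@[simp] theorem left_zero : c.left 0 = 1 := by simp [left]

@[simp] theorem right_zero : c.right 0 = 1 := by simp [right]

theorem left_add (τ σ : ℝ) : c.left (τ + σ) = c.left τ * φ (c.right τ) (c.left σ) := by
  simp [left, right, ofAdd_add]

theorem mdifferentiable_left : MDifferentiable 𝓘(ℝ, ℝ) 𝓘(ℝ, E) c.left :=
  c.contMDiff_left.mdifferentiable (by simp)

/-- The differentials at `1` of the automorphisms in a one-parameter group. -/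
def linearPart (τ : ℝ) : E →L[ℝ] E := dmap (φ (c.right τ)) 1

theorem linearPart_zero : c.linearPart 0 = ContinuousLinearMap.id ℝ E := by
  have : (φ (c.right 0) : N → N) = fun x ↦ x := by ext; simp
  rw [linearPart, this, dmap_id]

/-- The initial velocity of the orbit of `1`. -/
def velocity : E := (dmap c.left 0 : ℝ →L[ℝ] E) 1

variable {c} (hφ : ContMDiff (𝓘(ℝ, F).prod 𝓘(ℝ, E)) 𝓘(ℝ, E) ∞ fun p : H × N ↦ φ p.1 p.2)

include hφ

/-- Differentiate the cocycle identity for $\sigma=\tau+(\sigma-\tau)$ at $\sigma=\tau$: the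
velocity at time 0 is moved by the automorphism and then by left translation. -/
theorem dmap_left (τ : ℝ) : (dmap c.left τ : ℝ →L[ℝ] E) 1
    = dLeft E (c.left τ) (c.linearPart τ c.velocity) := by
  have h0 : c.left = fun σ ↦ c.left τ * φ (c.right τ) (c.left (σ + -τ)) := by
    ext σ
    rw [← left_add]; congr 1; ring
  have hsub : MDifferentiableAt 𝓘(ℝ, ℝ) 𝓘(ℝ, ℝ) (fun σ : ℝ ↦ σ + -τ) τ :=
    DifferentiableAt.mdifferentiableAt (by fun_prop)
  have h1 : MDifferentiableAt 𝓘(ℝ, ℝ) 𝓘(ℝ, E) (fun σ ↦ c.left (σ + -τ)) τ :=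
    (c.mdifferentiable_left _).comp τ hsub
  have h2 : MDifferentiableAt 𝓘(ℝ, ℝ) 𝓘(ℝ, E) (fun σ ↦ φ (c.right τ) (c.left (σ + -τ))) τ :=
    (mdifferentiable_action hφ (c.right τ) _).comp τ h1
  have hτ : c.left (τ + -τ) = 1 := by simp
  have h3 : fderiv ℝ (fun σ : ℝ ↦ σ + -τ) τ 1 = 1 := by simp
  have h4 : (dmap c.left τ : ℝ →L[ℝ] E)
      = dmap (fun σ ↦ c.left τ * φ (c.right τ) (c.left (σ + -τ))) τ :=
    congrArg (fun f : ℝ → N ↦ (dmap f τ : ℝ →L[ℝ] E)) h0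
  rw [h4, dmap_comp_apply (g := fun x ↦ c.left τ * x)
    (f := fun σ ↦ φ (c.right τ) (c.left (σ + -τ))) (mdifferentiable_leftMul E _ _) h2,
    dmap_comp_apply (g := φ (c.right τ)) (f := fun σ ↦ c.left (σ + -τ))
      (mdifferentiable_action hφ (c.right τ) _) h1,
    dmap_comp_apply (g := c.left) (f := fun σ ↦ σ + -τ) (c.mdifferentiable_left _) hsub,
    dmap_eq_fderiv, h3, hτ, map_one, add_neg_cancel]
  rfl

theorem differentiableAt_linearPart : DifferentiableAt ℝ c.linearPart 0 := by
  have h : ContDiffAt ℝ ∞ (fun p : ℝ × E ↦ chartOne E N (φ (c.right p.1) (param E N p.2)))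
      (0, originPt E N) := by
    rw [← contMDiffAt_iff_contDiffAt]
    have h1 : ContMDiffAt 𝓘(ℝ, ℝ × E) 𝓘(ℝ, F) ∞ (fun p : ℝ × E ↦ c.right p.1)
        (0, originPt E N) :=
      c.contMDiff_right.contMDiffAt.comp (0, originPt E N) contDiff_fst.contMDiff.contMDiffAt
    have h2 : ContMDiffAt 𝓘(ℝ, ℝ × E) 𝓘(ℝ, E) ∞ (fun p : ℝ × E ↦ param E N p.2)
        (0, originPt E N) :=
      contMDiffAt_param.comp (0, originPt E N) contDiff_snd.contMDiff.contMDiffAt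
    have h3 : ContMDiffAt 𝓘(ℝ, ℝ × E) 𝓘(ℝ, E) ∞
        (fun p : ℝ × E ↦ φ (c.right p.1) (param E N p.2)) (0, originPt E N) :=
      hφ.contMDiffAt.comp (0, originPt E N) (h1.prodMk h2)
    have h4 : ContMDiffAt 𝓘(ℝ, E) 𝓘(ℝ, E) ∞ (chartOne E N)
        (φ (c.right (0, originPt E N).1) (param E N (0, originPt E N).2)) := by
      simpa using contMDiffAt_chartOne
    exact h4.comp (0, originPt E N) h3
  have h' := (hasFDerivAt_partial h).differentiableAt
  refine h'.congr_of_eventuallyEq (Eventually.of_forall fun τ ↦ ?_)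
  exact dmap_one_eq (mdifferentiable_action hφ _ 1) (map_one _)

/-- The infinitesimal generator of a one-parameter family of Lie algebra automorphisms starting at
the identity is a derivation. -/
theorem deriv_linearPart_ad (X Y : E) : deriv c.linearPart 0 (ad E N X Y)
    = ad E N (deriv c.linearPart 0 X) Y + ad E N X (deriv c.linearPart 0 Y) := by
  have hD := (differentiableAt_linearPart (c := c) hφ).hasDerivAt
  have h1 := hD.clm_apply (hasDerivAt_const 0 (ad E N X Y))
  have hX := hD.clm_apply (hasDerivAt_const 0 X)
  have hY := hD.clm_apply (hasDerivAt_const 0 Y)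
  have h2 := ((ad E N).hasFDerivAt.comp_hasDerivAt (0 : ℝ) hX).clm_apply hY
  have heq : (fun τ ↦ c.linearPart τ (ad E N X Y))
      = fun τ ↦ ad E N (c.linearPart τ X) (c.linearPart τ Y) := by
    ext τ
    exact dmap_ad (f := (φ (c.right τ)).toMonoidHom) (mdifferentiable_action hφ _ 1) X Y
  rw [heq] at h1
  have := h1.unique h2
  simpa [linearPart_zero] using this

theorem form_deriv_linearPart {g : PseudoRiemannianMetric E N}
    (hiso : ∀ a : N ⋊[φ] H, g.IsIsometry (cosetAct a)) (X Y : E) :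
    g.form 1 (deriv c.linearPart 0 X) Y = - g.form 1 X (deriv c.linearPart 0 Y) := by
  have hD := (differentiableAt_linearPart (c := c) hφ).hasDerivAt
  have hX := hD.clm_apply (hasDerivAt_const 0 X)
  have hY := hD.clm_apply (hasDerivAt_const 0 Y)
  have h2 := ((g.form 1).hasFDerivAt.comp_hasDerivAt (0 : ℝ) hX).clm_apply hY
  have heq : (fun τ ↦ g.form 1 (c.linearPart τ X) (c.linearPart τ Y))
      = fun _ ↦ g.form 1 X Y := by
    ext τ
    exact form_dmap_of_isIsometry hiso _ X Y
  have h3 := h2.unique (heq ▸ hasDerivAt_const (0 : ℝ) (g.form 1 X Y))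
  simp only [linearPart_zero, Function.comp, map_zero, add_zero,
    ContinuousLinearMap.coe_id', id] at h3
  linarith

omit hφ

theorem hasDerivAt_Ad_left :
    HasDerivAt (fun τ ↦ Ad E (c.left τ)) (ad E N c.velocity) 0 := by
  have h1 : HasDerivAt (fun τ ↦ chartOne E N (c.left τ)) c.velocity 0 := by
    have hd : MDifferentiableAt 𝓘(ℝ, ℝ) 𝓘(ℝ, E) (fun τ ↦ chartOne E N (c.left τ)) 0 :=
      MDifferentiableAt.comp (g := chartOne E N) 0
        (by rw [left_zero]; exact mdifferentiableAt_chartOne) (c.mdifferentiable_left 0)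
    have h := dmap_comp_apply (g := chartOne E N) (f := c.left) (x := 0)
      (by rw [left_zero]; exact mdifferentiableAt_chartOne) (c.mdifferentiable_left 0) 1
    rw [left_zero, dmap_chartOne, dmap_eq_fderiv, fderiv_apply_one_eq_deriv] at h
    have h' := hd.differentiableAt.hasDerivAt
    rw [h] at h'
    exact h'
  have h2 := (hasFDerivAt_Ad (E := E) (N := N)).comp_hasDerivAt_of_eq 0 h1 (by simp)
  refine h2.congr_of_eventuallyEq ?_
  have hc : ContinuousAt c.left 0 := (c.mdifferentiable_left 0).continuousAt
  filter_upwards [hc.eventually (by rw [left_zero]; exact eventually_param_chartOne (E := E))] with τ hτ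
  simp only [Function.comp, hτ]

end OneParameterSubgroup

/-- The geodesic orbit property of the tangent vector `T` at `1`. -/
theorem IsGeodesicOrbit.exists_derivation [FiniteDimensional ℝ E] {g : PseudoRiemannianMetric E N}
    (hφ : ContMDiff (𝓘(ℝ, F).prod 𝓘(ℝ, E)) 𝓘(ℝ, E) ∞ fun p : H × N ↦ φ p.1 p.2)
    (hiso : ∀ a : N ⋊[φ] H, g.IsIsometry (cosetAct a)) (hgo : IsGeodesicOrbit F g φ) (T : E) :
    ∃ A : E →L[ℝ] E, (∀ X Y, A (ad E N X Y) = ad E N (A X) Y + ad E N X (A Y)) ∧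
      (∀ X Y, g.form 1 (A X) Y = - g.form 1 X (A Y)) ∧
      ∃ k : ℝ, ∀ K, g.form 1 T (ad E N T K) = g.form 1 (A T) K + k * g.form 1 T K := by
  have hg := PseudoRiemannianMetric.isLeftInvariant_of_isIsometry hiso
  obtain ⟨ε, hε, γ, hγ0, hgeo, hmom⟩ := hg.exists_geodesic T
  have h0 : (0 : ℝ) ∈ Set.Ioo (-ε) ε := ⟨by linarith, hε⟩
  obtain ⟨c, θ, hθ, hθ0, hθ', horb⟩ := hgo γ _ isOpen_Ioo Set.ordConnected_Ioo hgeo 0 h0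
  have horb' : ∀ᶠ t in 𝓝 0, γ t = c.left (θ t) := by
    filter_upwards [horb] with t ht
    rw [ht, hγ0]
    simp [cosetAct, OneParameterSubgroup.left]
  have hdθ : ∀ᶠ t in 𝓝 0, DifferentiableAt ℝ θ t :=
    ((hθ.of_le (m := 1) (by norm_cast)).eventually (by simp)).mono
      fun t ht ↦ ht.differentiableAt (by simp)
  -- The conserved momentum is tested on $\mathrm{Ad}(\gamma(t))K$, whose right-invariant field
  -- agrees at $\gamma(t)$ with the left-invariant field of $K$; left invariance then brings the
  -- pairing back to 1.
  have hkey : ∀ K, ∀ᶠ t in 𝓝 0, deriv θ t * g.form 1 (c.linearPart (θ t) c.velocity) K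
      = g.form 1 T (Ad E (c.left (θ t)) K) := by
    intro K
    filter_upwards [horb'.eventually_nhds, hdθ, isOpen_Ioo.mem_nhds h0] with t ht1 ht2 ht3
    have h1 := hmom t ht3 (Ad E (γ t) K)
    rw [dmap_congr ht1, dmap_comp_apply (g := c.left) (f := θ) (c.mdifferentiable_left _)
      ht2.mdifferentiableAt, dmap_eq_fderiv, fderiv_apply_one_eq_deriv,
      ← mul_one (deriv θ t), ← smul_eq_mul, map_smul, OneParameterSubgroup.dmap_left hφ,
      ← ContinuousLinearMap.comp_apply (dRight E (γ t)), dRight_comp_Ad, ht1.self_of_nhds,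
      map_smul] at h1
    rw [← h1, smul_apply, smul_eq_mul]
    congr 1
    have h2 := hg (c.left (θ t)) 1 (c.linearPart (θ t) c.velocity) K
    rw [mul_one] at h2
    exact h2.symm
  set D := deriv c.linearPart 0 with hD
  have hT : T = deriv θ 0 • c.velocity := by
    rw [← sub_eq_zero]
    refine g.eq_zero_of_form 1 _ fun K ↦ ?_
    have := (hkey K).self_of_nhds
    simp only [hθ0, OneParameterSubgroup.linearPart_zero, OneParameterSubgroup.left_zero, Ad_one,
      ContinuousLinearMap.coe_id', id] at this
    simp only [map_sub, map_smul, sub_apply, smul_apply,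
      smul_eq_mul]
    linarith
  -- With $T=\theta'v$, the derivative of the momentum identity at 0 is $\theta''\langle
  -- v,K\rangle+\theta'^2\langle Dv,K\rangle=\theta'\langle T,[v,K]\rangle$. This dictates
  -- $A=\theta'D$ and $k=\theta''/\theta'$.
  refine ⟨deriv θ 0 • D, fun X Y ↦ ?_, fun X Y ↦ ?_, deriv (deriv θ) 0 / deriv θ 0, fun K ↦ ?_⟩
  · simp only [smul_apply, map_smul, hD,
      OneParameterSubgroup.deriv_linearPart_ad hφ, smul_add]
  · simp only [smul_apply, map_smul, hD,
      OneParameterSubgroup.form_deriv_linearPart hφ hiso, smul_neg]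
  have hθd : HasDerivAt θ (deriv θ 0) 0 := (hdθ.self_of_nhds).hasDerivAt
  have hθdd : HasDerivAt (deriv θ) (deriv (deriv θ) 0) 0 := by
    have h1 : ContDiffAt ℝ 1 (deriv θ) 0 :=
      (hθ.fderiv_right (m := 1) (by norm_cast)).clm_apply contDiffAt_const
    exact (h1.differentiableAt (by simp)).hasDerivAt
  have hDD : HasDerivAt c.linearPart D 0 :=
    (OneParameterSubgroup.differentiableAt_linearPart hφ).hasDerivAt
  have hL := ((g.form 1).hasFDerivAt.comp_hasDerivAt (0 : ℝ)
    ((hDD.scomp_of_eq 0 hθd hθ0.symm).clm_apply (hasDerivAt_const 0 c.velocity))).clm_apply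
      (hasDerivAt_const 0 K)
  have hR := (g.form 1 T).hasFDerivAt.comp_hasDerivAt (0 : ℝ)
    ((OneParameterSubgroup.hasDerivAt_Ad_left (c := c).scomp_of_eq 0 hθd hθ0.symm).clm_apply
      (hasDerivAt_const 0 K))
  have heq := (hθdd.mul hL).unique (hR.congr_of_eventuallyEq (hkey K))
  simp only [Function.comp, hθ0, OneParameterSubgroup.linearPart_zero, map_zero, add_zero, map_smul,
    ContinuousLinearMap.coe_id', id, smul_apply, smul_eq_mul] at heq
  rw [hT] at heq ⊢
  simp only [map_smul, smul_apply, smul_eq_mul] at heq ⊢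
  rw [← mul_assoc (deriv (deriv θ) 0 / deriv θ 0), div_mul_cancel₀ _ hθ']
  linear_combination - heq

end Orbits

/-! ### Signature and conclusion -/

theorem three_le_sigNeg {V : Type*} [AddCommGroup V] [Module ℝ V] [FiniteDimensional ℝ V]
    (Q : QuadraticForm ℝ V) {v : Fin 3 → V} {q : Fin 3 → ℝ} (hq : ∀ i, q i < 0)
    (hv : ∀ a : Fin 3 → ℝ, Q (∑ i, a i • v i) = ∑ i, a i ^ 2 * q i) : 3 ≤ sigNeg Q := by
  -- Gives both the independence of the three vectors and the negative definiteness of their span.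
  have hzero : ∀ a : Fin 3 → ℝ, 0 ≤ Q (∑ i, a i • v i) → a = 0 := by
    intro a ha
    rw [hv] at ha
    have h1 : ∀ i ∈ Finset.univ, a i ^ 2 * q i ≤ 0 := fun i _ ↦
      mul_nonpos_of_nonneg_of_nonpos (sq_nonneg _) (hq i).le
    have h2 := (Finset.sum_eq_zero_iff_of_nonpos h1).mp (le_antisymm (Finset.sum_nonpos h1) ha)
    ext i
    simpa [(hq i).ne] using h2 i (Finset.mem_univ i)
  have hli : LinearIndependent ℝ v := Fintype.linearIndependent_iff.mpr fun a ha i ↦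
    congrFun (hzero a (by simp [ha])) i
  have h3 : Module.finrank ℝ (Submodule.span ℝ (Set.range v)) = 3 := by
    rw [finrank_span_eq_card hli, Fintype.card_fin]
  rw [← h3]
  refine le_sigNeg_of_negDef Q fun x hx ↦ ?_
  obtain ⟨a, ha⟩ := (Submodule.mem_span_range_iff_exists_fun ℝ).mp x.2
  change 0 < - Q (x : V)
  rw [← ha, Left.neg_pos_iff]
  by_contra! h
  refine hx (Subtype.ext ?_)
  rw [← ha, hzero a h]
  simp

namespace PseudoRiemannianMetric

variable {E : Type*} [NormedAddCommGroup E] [NormedSpace ℝ E]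
  {N : Type*} [TopologicalSpace N] [ChartedSpace E N] [Group N] [LieGroup 𝓘(ℝ, E) ∞ N]
  (g : PseudoRiemannianMetric E N)

/-- The Lie algebra of the group, with the scalar product given by the metric. -/
def lieAlgebra : MetricLieAlgebra E where
  br := ContinuousLinearMap.coeLM ℝ ∘ₗ (ad E N : E →ₗ[ℝ] E →L[ℝ] E)
  form := ContinuousLinearMap.coeLM ℝ ∘ₗ (g.form 1 : E →ₗ[ℝ] E →L[ℝ] ℝ)
  br_swap := ad_swap
  jacobi := ad_jacobi
  symm := g.form_symm 1

variable {g}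

/-- Otherwise the three orthogonal vectors would span a negative definite 3-space, against the two
negative squares. The algebraic argument uses the signature only in this form. -/
theorem nonneg_of_orthogonal_of_isTransLorentz [FiniteDimensional ℝ E] (hg : g.IsTransLorentz)
    (p : N) {x y z : E} (hx : g.form p x x < 0) (hy : g.form p y y < 0) (hxy : g.form p x y = 0)
    (hxz : g.form p x z = 0) (hyz : g.form p y z = 0) : 0 ≤ g.form p z z := by
  by_contra! hz
  have hfin : FiniteDimensional ℝ (TangentSpace 𝓘(ℝ, E) p) :=
    inferInstanceAs (FiniteDimensional ℝ E)
  have h : 3 ≤ sigNeg (g.quadraticForm p) := by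
    refine three_le_sigNeg (g.quadraticForm p)
      (v := ![(x : TangentSpace 𝓘(ℝ, E) p), y, z])
      (q := ![g.form p x x, g.form p y y, g.form p z z]) ?_ fun a ↦ ?_
    · intro i
      fin_cases i
      exacts [hx, hy, hz]
    · have hQ : ∀ v : E, g.quadraticForm p v = g.form p v v := fun v ↦ rfl
      simp only [Fin.sum_univ_three, Matrix.cons_val]
      refine (hQ (a 0 • x + a 1 • y + a 2 • z)).trans ?_
      simp only [map_add, map_smul, add_apply, smul_apply, smul_eq_mul, hxy, hxz, hyz,
        g.form_symm p y x, g.form_symm p z x, g.form_symm p z y]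
      ring
  have := (hg p).2
  omega

end PseudoRiemannianMetric

/-- Over a nilpotent group, the geodesic orbit property of a trans-Lorentz metric which is
nondegenerate on the derived algebra forces the second commutators to vanish. -/
theorem ad_ad_eq_zero_of_isGeodesicOrbit
    {E : Type*} [NormedAddCommGroup E] [NormedSpace ℝ E] [FiniteDimensional ℝ E]
    {N : Type*} [TopologicalSpace N] [ChartedSpace E N] [Group N] [LieGroup 𝓘(ℝ, E) ∞ N]
    (hN : Group.IsNilpotent N)
    {F : Type*} [NormedAddCommGroup F] [NormedSpace ℝ F]
    {H : Type*} [TopologicalSpace H] [ChartedSpace F H] [Group H] [LieGroup 𝓘(ℝ, F) ∞ H]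
    {φ : H →* MulAut N}
    (hφ : ContMDiff (𝓘(ℝ, F).prod 𝓘(ℝ, E)) 𝓘(ℝ, E) ∞ fun p : H × N ↦ φ p.1 p.2)
    {g : PseudoRiemannianMetric E N} (hg : g.IsTransLorentz)
    (hiso : ∀ a : N ⋊[φ] H, g.IsIsometry (cosetAct a))
    (hgo : IsGeodesicOrbit F g φ) (hder : IsNondegenerateOnDerived g) (X Y Z : E) :
    ad E N X (ad E N Y Z) = 0 := by
  have hGO : g.lieAlgebra.IsGO := fun T ↦ by
    obtain ⟨A, h1, h2, k, h3⟩ := hgo.exists_derivation hφ hiso T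
    exact ⟨A, h1, h2, k, h3⟩
  have hnd : g.lieAlgebra.form.Nondegenerate :=
    ⟨fun x hx ↦ g.eq_zero_of_form 1 x hx,
      fun x hx ↦ g.eq_zero_of_form 1 x fun y ↦ (g.form_symm 1 x y).trans (hx y)⟩
  have hderived : ∀ x : E, x ∈ g.lieAlgebra.derived ↔ x ∈ derivedAlgebra E N := by
    intro x
    have : {z : E | ∃ x y, g.lieAlgebra.br x y = z}
        = {z | ∃ x y : GroupLieAlgebra 𝓘(ℝ, E) N, ⁅x, y⁆ = z} := by
      simp only [bracket_eq_ad]; rfl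
    change x ∈ Submodule.span ℝ {z : E | ∃ x y, g.lieAlgebra.br x y = z} ↔ _
    rw [this]
    exact Iff.rfl
  obtain ⟨c, hc⟩ := exists_prod_ad_eq_zero (E := E) hN
  have hnil : ∀ l : List E, l.length = c → (l.map g.lieAlgebra.br).prod = 0 := by
    intro l hl
    have h := congrArg
      (ContinuousLinearMap.toLinearMapRingHom : (E →L[ℝ] E) →+* Module.End ℝ E) (hc l hl)
    rw [map_list_prod, List.map_map, map_zero] at h
    exact h
  exact hGO.two_step hnd (fun x hx h ↦ hder x ((hderived x).mp hx) fun y hy ↦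
    h y ((hderived y).mpr hy)) (fun x y z ↦
      PseudoRiemannianMetric.nonneg_of_orthogonal_of_isTransLorentz hg 1) hnil X Y Z

end
theorem theorem1
    {E : Type*} [NormedAddCommGroup E] [NormedSpace ℝ E] [FiniteDimensional ℝ E]
    {N : Type*} [TopologicalSpace N] [T2Space N] [ConnectedSpace N] [ChartedSpace E N] [Group N]
    [LieGroup 𝓘(ℝ, E) ∞ N] (hN : Group.IsNilpotent N)
    {F : Type*} [NormedAddCommGroup F] [NormedSpace ℝ F] [FiniteDimensional ℝ F]
    {H : Type*} [TopologicalSpace H] [T2Space H] [ChartedSpace F H] [Group H]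
    [LieGroup 𝓘(ℝ, F) ∞ H]
    (φ : H →* MulAut N)
    (hφ : ContMDiff (𝓘(ℝ, F).prod 𝓘(ℝ, E)) 𝓘(ℝ, E) ∞ fun p : H × N ↦ φ p.1 p.2)
    (g : PseudoRiemannianMetric E N) (hg : g.IsTransLorentz)
    (hiso : ∀ a : N ⋊[φ] H, g.IsIsometry (cosetAct a))
    (hgo : IsGeodesicOrbit F g φ)
    (hder : IsNondegenerateOnDerived g) :
    (∀ a b : N, a * b = b * a) ∨ Group.nilpotencyClass N = 2 := by
  have h2 := nilpotencyClass_le_two (E := E) hN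
    (ad_ad_eq_zero_of_isGeodesicOrbit hN hφ hg hiso hgo hder)
  -- Class 0 or 1 is the abelian case, which includes the trivial group.
  rcases Nat.lt_or_ge (Group.nilpotencyClass N) 2 with h | h
  · left
    have := Group.IsNilpotent.nilpotencyClass_le_one_iff.mp (Nat.le_of_lt_succ h)
    exact this.is_comm.comm
  · exact Or.inr (le_antisymm h2 h)
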